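/- Let $A\subset\mathbb C$ be a finite nonempty set, $M$ a number of sub-bands, and, for each $N$, let $\mathbf a(N)\in\{1,\dots,M\}^N$ be a deterministic sub-band selection vector such that $\frac1N|\{k: a_k(N)=m\}|\to\delta_m$ as $N\to\infty$, with $\delta_m>0$ for every $m$. For each $N$ let $\mathbf V=\mathbf V(N)$ be a Haar-distributed random $N\times N$ unitary matrix. For $\mathbf r\in\mathbb C^N$ put $\phi_m(\mathbf r)=\frac1N\sum_{k:\,a_k(N)=m}|r_k|^2$. Let $\mathbf s=(s_1,\dots,s_M)$ with $s_m\ge 0$ and $s_{\rm tot}=\sum_m s_m>0$, let $\nu_m=s_m/s_{\rm tot}$, and for $\epsilon>0$ let $$G_N(\mathbf V,\epsilon)=\{\mathbf x\in A^N:\ \phi_m(\mathbf V\mathbf x)\in[s_m-\epsilon,s_m]\ \text{for all } m\}.$$ Assume that $M=1$ or $s_{\rm tot}\ne\min_{x\in A}|x|^2$. Then, in $[-\infty,\infty]$ and with $\log 0=-\infty$, the limit $\lim_{N\to\infty}\frac1N\log\mathbb E|G_N(\mathbf V,\epsilon)|$ exists for all sufficiently small $\epsilon>0$, and $$\lim_{\epsilon\downarrow0}\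 \lim_{N\to\infty}\frac1N\log\mathbb E|G_N(\mathbf V,\epsilon)|=H_{\max}(s_{\rm tot})-D(\boldsymbol\delta\|\boldsymbol\nu).$$ Here $H_{\max}(s)$ is the maximum of the entropy $H(X)$ over all random variables $X$ with values in $A$ and $\mathbb E|X|^2=s$ (and $-\infty$ if there are none), $D(\boldsymbol\delta\|\boldsymbol\nu)=\sum_m\delta_m\log(\delta_m/\nu_m)$ (and $+\infty$ if $\nu_m=0$ for some $m$), and all logarithms are natural. -/

import Mathlib

open MeasureTheory Filter Topology
open scoped ENNReal

/-- The Borel σ-algebra on the group of `N × N` unitary matrices. -/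
noncomputable instance unitaryGroupMeasurableSpace (N : ℕ) :
    MeasurableSpace (Matrix.unitaryGroup (Fin N) ℂ) :=
  borel _

instance unitaryGroupBorelSpace (N : ℕ) :
    BorelSpace (Matrix.unitaryGroup (Fin N) ℂ) :=
  ⟨rfl⟩

/-- A random unitary matrix `V` on the probability space `(Ω, P)` is Haar-distributed: it is
measurable and its law is a Haar measure on the unitary group (which is then the normalized one,
since the law is a probability measure). -/
structure IsHaarDistributed {Ω : Type*} [MeasurableSpace Ω] (P : Measure Ω) {N : ℕ}
    (V : Ω → Matrix.unitaryGroup (Fin N) ℂ) : Prop where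
  measurable : Measurable V
  isHaarMeasure_map : (P.map V).IsHaarMeasure

/-- The fraction of the frequencies `k` that a sub-band selection vector `a` puts in
sub-band `m`. -/
noncomputable def bandFraction {N M : ℕ} (a : Fin N → Fin M) (m : Fin M) : ℝ :=
  (1 / (N : ℝ)) * ∑ k : Fin N, if a k = m then (1 : ℝ) else 0

/-- The energy per sample of `r` in sub-band `m`. -/
noncomputable def bandEnergy {N M : ℕ} (a : Fin N → Fin M) (r : Fin N → ℂ) (m : Fin M) : ℝ :=
  (1 / (N : ℝ)) * ∑ k : Fin N, if a k = m then ‖r k‖ ^ 2 else 0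

open Classical in
/-- The sequences `x ∈ A ^ N` whose transform `U x` has energy in `[s m - ε, s m]` in every
sub-band `m`. -/
noncomputable def admissibleSeqs {N M : ℕ} (A : Finset ℂ) (a : Fin N → Fin M) (s : Fin M → ℝ)
    (U : Matrix (Fin N) (Fin N) ℂ) (ε : ℝ) : Finset (Fin N → ℂ) :=
  (Fintype.piFinset fun _ : Fin N => A).filter fun x =>
    ∀ m, bandEnergy a (U.mulVec x) m ∈ Set.Icc (s m - ε) (s m)

/-- The annealed rate `(1 / N) log 𝔼 |G_N(V, ε)|` at block length `N`, with natural logarithm and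
`log 0 = -∞`. -/
noncomputable def annealedRate {Ω : Type*} [MeasurableSpace Ω] (P : Measure Ω) {N M : ℕ}
    (A : Finset ℂ) (a : Fin N → Fin M) (s : Fin M → ℝ)
    (V : Ω → Matrix.unitaryGroup (Fin N) ℂ) (ε : ℝ) : EReal :=
  ENNReal.log (∫⁻ ω, ((admissibleSeqs A a s (V ω : Matrix (Fin N) (Fin N) ℂ) ε).card : ℝ≥0∞) ∂P)
    / ((N : ℝ) : EReal)

/-- Shannon entropy (natural logarithm) of a probability vector on the points of `A`. -/
noncomputable def shannonEntropy {A : Finset ℂ} (p : A → ℝ) : ℝ :=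
  ∑ x : A, Real.negMulLog (p x)

/-- The probability distributions on `A` with second moment `s`. -/
def distributionsWithSecondMoment (A : Finset ℂ) (s : ℝ) : Set (A → ℝ) :=
  {p | p ∈ stdSimplex ℝ A ∧ ∑ x : A, p x * ‖(x : ℂ)‖ ^ 2 = s}

/-- The maximum entropy of a random variable on `A` with second moment `s`; it is `-∞` if there
is no such random variable. -/
noncomputable def maxEntropy (A : Finset ℂ) (s : ℝ) : EReal :=
  ⨆ p ∈ distributionsWithSecondMoment A s, (shannonEntropy p : EReal)

/-- The supremum that defines `maxEntropy` is a maximum. -/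
theorem exists_shannonEntropy_eq_maxEntropy (A : Finset ℂ) (s : ℝ)
    (h : (distributionsWithSecondMoment A s).Nonempty) :
    ∃ p ∈ distributionsWithSecondMoment A s, (shannonEntropy p : EReal) = maxEntropy A s := by
  have hc : IsCompact (distributionsWithSecondMoment A s) := by
    refine (isCompact_stdSimplex ℝ A).inter_right (t := {p | ∑ x : A, p x * ‖(x : ℂ)‖ ^ 2 = s}) ?_
    exact isClosed_eq (by fun_prop) continuous_const
  have hcont : Continuous (shannonEntropy (A := A)) :=
    continuous_finsetSum _ fun x _ => Real.continuous_negMulLog.comp (continuous_apply x)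
  obtain ⟨p, hp, hmax⟩ := hc.exists_isMaxOn h hcont.continuousOn
  refine ⟨p, hp, le_antisymm (le_iSup₂ (f := fun p _ => (shannonEntropy p : EReal)) p hp) ?_⟩
  exact iSup₂_le fun q hq => EReal.coe_le_coe_iff.2 (hmax hq)

open Classical in
/-- Relative entropy `D(δ ‖ ν) = ∑ m, δ m * log (δ m / ν m)` of finite probability vectors, with
`0 log (0 / ν) = 0`, and `+∞` if `ν m = 0 < δ m` for some `m`. -/
noncomputable def relativeEntropy {M : ℕ} (δ ν : Fin M → ℝ) : EReal :=
  if ∀ m, ν m = 0 → δ m = 0 then ((∑ m, δ m * Real.log (δ m / ν m) : ℝ) : EReal) else ⊤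

/-! The expectation is the sum over `x ∈ A ^ N` of the probability that the band energies of `V x`
lie in the box. By Haar invariance `V x` is uniform on a sphere, so the probability of a
scale-invariant event does not depend on `x ≠ 0` and equals the fraction of a ball's volume lying in
a cone (`IsHaarDistributed.measure_cone_mul_volume`). Band conditions cut out products of balls or
shells, and the ratio of a product of balls to the full ball is the multinomial weight `bandWeight`.
By Stirling its rate is `-D(δ ‖ φ / ∑ φ)` (`tendsto_log_bandWeight`), where `φ` denotes the band
energies.

About `exp (N H(p))` sequences have empirical distribution near `p`, so a pair `(p, φ)` contributes
at rate `H(p) - D(δ ‖ φ / ∑ φ)`, which is `pairRate`. Unitarity allows only pairs with `meanEnergy p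
= ∑ φ`. At fixed small `ε` the limit is the supremum of `pairRate` over `feasiblePairs`: the upper
bound covers a compact set by neighbourhoods of small rate (`exists_expectedCount_le`), and the
lower bound perturbs a feasible pair into the interior of the box, where typical sequences and thin
shells suffice (`eventually_le_sum_measure`). Compactness and continuity then give the limit `ε ↓ 0`
(`tendsto_iSup_pairRate`).

Interior pairs need a symbol of energy below `s_tot`. If `s_tot` is smaller than every symbol
energy, both sides are `-∞`. If it equals the least one, the box forces the band energies to be
exactly `s`; this is an event of full probability for one band, treated directly, and a null event
for several positive bands, which is why that case is excluded. If some `s m = 0`, a nonzero vector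
almost surely violates the constraint and the rate is `-∞`. -/

/-! ### Haar invariance and the energies of a vector. -/

instance unitaryGroup_compactSpace (N : ℕ) : CompactSpace (Matrix.unitaryGroup (Fin N) ℂ) := by
  refine isCompact_iff_compactSpace.1 ?_
  have hK : IsCompact (X := Matrix (Fin N) (Fin N) ℂ)
      (Set.univ.pi fun _ : Fin N => Set.univ.pi fun _ : Fin N => Metric.closedBall (0 : ℂ) 1) :=
    isCompact_univ_pi fun _ => isCompact_univ_pi fun _ => isCompact_closedBall 0 1
  refine hK.of_isClosed_subset ?_ ?_
  · have : (Matrix.unitaryGroup (Fin N) ℂ : Set (Matrix (Fin N) (Fin N) ℂ)) =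
        {U | U * star U = 1} := Set.ext fun _ => Matrix.mem_unitaryGroup_iff
    rw [this]
    exact isClosed_eq (by fun_prop) continuous_const
  · intro U hU i _ j _
    simpa using entry_norm_bound_of_unitary hU i j

/-- A right translate of a Haar measure is again Haar, and the Haar probability measure is unique.
Right invariance is the side needed, since replacing `x` by `W x` replaces `V` by `V W`. -/
theorem unitaryGroup_map_mul_right_eq {N : ℕ} (μ : Measure (Matrix.unitaryGroup (Fin N) ℂ))
    [μ.IsHaarMeasure] [IsProbabilityMeasure μ] (W : Matrix.unitaryGroup (Fin N) ℂ) :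
    μ.map (· * W) = μ := by
  have : IsProbabilityMeasure (μ.map (· * W)) :=
    Measure.isProbabilityMeasure_map (by fun_prop)
  exact Measure.isHaarMeasure_eq_of_isProbabilityMeasure _ _

/-- The total energy of a vector. -/
noncomputable def totalEnergy {N : ℕ} (y : Fin N → ℂ) : ℝ := ∑ k, ‖y k‖ ^ 2

/-- The energy of a vector in sub-band `m`. -/
noncomputable def bandSum {N M : ℕ} (a : Fin N → Fin M) (y : Fin N → ℂ) (m : Fin M) : ℝ :=
  ∑ k : Fin N, if a k = m then ‖y k‖ ^ 2 else 0

theorem sum_bandSum {N M : ℕ} (a : Fin N → Fin M) (y : Fin N → ℂ) :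
    ∑ m, bandSum a y m = totalEnergy y := by
  simp only [bandSum, totalEnergy]
  rw [Finset.sum_comm]
  simp

theorem bandEnergy_eq {N M : ℕ} (a : Fin N → Fin M) (y : Fin N → ℂ) (m : Fin M) :
    bandEnergy a y m = bandSum a y m / N := by
  rw [bandEnergy, bandSum]; ring

theorem bandSum_nonneg {N M : ℕ} (a : Fin N → Fin M) (y : Fin N → ℂ) (m : Fin M) :
    0 ≤ bandSum a y m :=
  Finset.sum_nonneg fun _ _ => by split_ifs <;> positivity

theorem totalEnergy_nonneg {N : ℕ} (y : Fin N → ℂ) : 0 ≤ totalEnergy y :=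
  Finset.sum_nonneg fun _ _ => by positivity

theorem totalEnergy_pos {N : ℕ} {y : Fin N → ℂ} (hy : y ≠ 0) : 0 < totalEnergy y := by
  obtain ⟨k, hk⟩ := Function.ne_iff.1 hy
  exact Finset.sum_pos' (fun _ _ => by positivity) ⟨k, Finset.mem_univ _, by
    have : 0 < ‖y k‖ := norm_pos_iff.2 hk
    positivity⟩

theorem totalEnergy_eq_dotProduct {N : ℕ} (y : Fin N → ℂ) :
    ((totalEnergy y : ℝ) : ℂ) = star y ⬝ᵥ y := by
  simp [totalEnergy, dotProduct, Complex.conj_mul']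

theorem totalEnergy_mulVec {N : ℕ} (U : Matrix.unitaryGroup (Fin N) ℂ) (y : Fin N → ℂ) :
    totalEnergy ((U : Matrix (Fin N) (Fin N) ℂ).mulVec y) = totalEnergy y := by
  apply Complex.ofReal_injective
  rw [totalEnergy_eq_dotProduct, totalEnergy_eq_dotProduct, Matrix.star_mulVec,
    Matrix.dotProduct_mulVec, Matrix.vecMul_vecMul, ← Matrix.star_eq_conjTranspose,
    Matrix.UnitaryGroup.star_mul_self, Matrix.vecMul_one]

theorem bandSum_smul {N M : ℕ} (a : Fin N → Fin M) (c : ℝ) (y : Fin N → ℂ) (m : Fin M) :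
    bandSum a ((c : ℂ) • y) m = c ^ 2 * bandSum a y m := by
  simp only [bandSum, Finset.mul_sum]
  refine Finset.sum_congr rfl fun k _ => ?_
  split_ifs <;> simp [mul_pow]

theorem totalEnergy_smul {N : ℕ} (c : ℝ) (y : Fin N → ℂ) :
    totalEnergy ((c : ℂ) • y) = c ^ 2 * totalEnergy y := by
  simp [totalEnergy, Finset.mul_sum, mul_pow]

theorem measurable_bandSum {N M : ℕ} (a : Fin N → Fin M) (m : Fin M) :
    Measurable fun y : Fin N → ℂ => bandSum a y m :=
  Finset.measurable_fun_sum _ fun k _ => by split_ifs <;> fun_prop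

theorem measurable_totalEnergy {N : ℕ} : Measurable (totalEnergy (N := N)) := by
  unfold totalEnergy; fun_prop

/-- Transitivity on the unit sphere: complete `x` to an orthonormal basis with `x` in position `k`
and take the basis vectors as columns. -/
theorem exists_unitary_mulVec_single {N : ℕ} (k : Fin N) {x : Fin N → ℂ} (hx : totalEnergy x = 1) :
    ∃ W : Matrix.unitaryGroup (Fin N) ℂ,
      (W : Matrix (Fin N) (Fin N) ℂ).mulVec (Pi.single k 1) = x := by
  obtain ⟨b, hb⟩ := Orthonormal.exists_orthonormalBasis_extension_of_card_eq (𝕜 := ℂ)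
    (E := EuclideanSpace ℂ (Fin N)) (ι := Fin N) (by simp) (v := fun _ => WithLp.toLp 2 x)
    (s := {k}) (by
      refine ⟨fun i => ?_, fun i j hij => (hij (Subsingleton.elim i j)).elim⟩
      simp only [Set.domRestrict_apply, EuclideanSpace.norm_eq]
      rw [show ∑ i, ‖x i‖ ^ 2 = 1 from hx, Real.sqrt_one])
  refine ⟨⟨_, OrthonormalBasis.toMatrix_orthonormalBasis_mem_unitary
    (EuclideanSpace.basisFun (Fin N) ℂ) b⟩, ?_⟩
  have := hb k rfl
  rw [Matrix.mulVec_single_one]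
  ext i
  change (EuclideanSpace.basisFun (Fin N) ℂ).toBasis.toMatrix b i k = x i
  rw [Module.Basis.toMatrix_apply, this]
  simp

theorem IsHaarDistributed.measure_mulVec_mul {Ω : Type*} [MeasurableSpace Ω] {P : Measure Ω}
    [IsProbabilityMeasure P] {N : ℕ} {V : Ω → Matrix.unitaryGroup (Fin N) ℂ}
    (hV : IsHaarDistributed P V) (W : Matrix.unitaryGroup (Fin N) ℂ) {C : Set (Fin N → ℂ)}
    (hC : MeasurableSet C) (y : Fin N → ℂ) :
    P {ω | (V ω : Matrix (Fin N) (Fin N) ℂ).mulVec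
        ((W : Matrix (Fin N) (Fin N) ℂ).mulVec y) ∈ C} =
      P {ω | (V ω : Matrix (Fin N) (Fin N) ℂ).mulVec y ∈ C} := by
  have := hV.isHaarMeasure_map
  have : IsProbabilityMeasure (P.map V) := Measure.isProbabilityMeasure_map hV.measurable.aemeasurable
  have hm : Measurable fun U : Matrix.unitaryGroup (Fin N) ℂ =>
      (U : Matrix (Fin N) (Fin N) ℂ).mulVec y :=
    Continuous.measurable (by fun_prop)
  have h := congrArg (fun μ => μ ((fun U : Matrix.unitaryGroup (Fin N) ℂ =>
      (U : Matrix (Fin N) (Fin N) ℂ).mulVec y) ⁻¹' C)) (unitaryGroup_map_mul_right_eq (P.map V) W)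
  beta_reduce at h
  rw [Measure.map_apply (by fun_prop) (hm hC), Measure.map_apply hV.measurable (hm hC),
    Measure.map_apply hV.measurable] at h
  · simpa [Set.preimage, Matrix.mulVec_mulVec] using h
  · exact (measurable_mul_const W) (hm hC)

/-- The probability that a Haar unitary moves a nonzero vector into a cone does not depend on
the vector. -/
theorem IsHaarDistributed.measure_mulVec_mem_cone {Ω : Type*} [MeasurableSpace Ω] {P : Measure Ω}
    [IsProbabilityMeasure P] {N : ℕ} {V : Ω → Matrix.unitaryGroup (Fin N) ℂ}
    (hV : IsHaarDistributed P V) {C : Set (Fin N → ℂ)} (hC : MeasurableSet C)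
    (hcone : ∀ c : ℝ, 0 < c → ∀ y, (c : ℂ) • y ∈ C ↔ y ∈ C) {x y : Fin N → ℂ} (hx : x ≠ 0)
    (hy : y ≠ 0) :
    P {ω | (V ω : Matrix (Fin N) (Fin N) ℂ).mulVec x ∈ C} =
      P {ω | (V ω : Matrix (Fin N) (Fin N) ℂ).mulVec y ∈ C} := by
  obtain ⟨k, -⟩ := Function.ne_iff.1 hx
  suffices H : ∀ z : Fin N → ℂ, z ≠ 0 →
      P {ω | (V ω : Matrix (Fin N) (Fin N) ℂ).mulVec z ∈ C} =
        P {ω | (V ω : Matrix (Fin N) (Fin N) ℂ).mulVec (Pi.single k 1) ∈ C} by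
    rw [H x hx, H y hy]
  intro z hz
  have hT := totalEnergy_pos hz
  set c : ℝ := (√(totalEnergy z))⁻¹ with hc
  have hc0 : 0 < c := by positivity
  obtain ⟨W, hW⟩ := exists_unitary_mulVec_single k (x := (c : ℂ) • z) (by
    rw [totalEnergy_smul, hc, inv_pow, Real.sq_sqrt hT.le, inv_mul_cancel₀ hT.ne'])
  rw [← hV.measure_mulVec_mul W hC (Pi.single k 1), hW]
  simp only [Matrix.mulVec_smul, hcone c hc0]

/-! ### Probabilities of cones as volume ratios. -/

theorem volume_totalEnergy_le {ι : Type*} [Fintype ι] [Nonempty ι] {R : ℝ} (hR : 0 ≤ R) :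
    volume {y : ι → ℂ | ∑ k, ‖y k‖ ^ 2 ≤ R} =
      ENNReal.ofReal ((Real.pi * R) ^ Fintype.card ι / (Fintype.card ι).factorial) := by
  have h := Complex.volume_sum_rpow_le ι (p := 2) (by norm_num) (√R)
  have h2 : {x : ι → ℂ | (∑ i, ‖x i‖ ^ (2 : ℝ)) ^ (1 / (2 : ℝ)) ≤ √R} =
      {y : ι → ℂ | ∑ k, ‖y k‖ ^ 2 ≤ R} := by
    ext x
    simp only [Set.mem_ofPred_eq, Real.rpow_two, ← Real.sqrt_eq_rpow]
    rw [Real.sqrt_le_sqrt_iff hR]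
  rw [h2] at h
  rw [h, ← ENNReal.ofReal_pow (by positivity), ← ENNReal.ofReal_mul (by positivity), pow_mul,
    Real.sq_sqrt hR]
  congr 1
  rw [show (2 : ℝ) / 2 + 1 = 2 by norm_num, mul_div_cancel_left₀ _ (two_ne_zero' ℝ),
    Real.Gamma_nat_eq_factorial, Real.Gamma_two, mul_one, mul_pow]
  ring

/-- Linear maps scale volume by a constant; the constant is 1 because the unit ball is preserved and
has finite positive volume. This avoids computing the determinant of the underlying real map. -/
theorem volume_preimage_mulVec {N : ℕ} (U : Matrix.unitaryGroup (Fin N) ℂ) (S : Set (Fin N → ℂ)) :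
    volume {y : Fin N → ℂ | (U : Matrix (Fin N) (Fin N) ℂ).mulVec y ∈ S} = volume S := by
  rcases isEmpty_or_nonempty (Fin N) with hN | hN
  · congr 1
    ext y
    rw [Set.mem_ofPred_eq, Subsingleton.elim (Matrix.mulVec _ y) y]
  let f : (Fin N → ℂ) →ₗ[ℝ] (Fin N → ℂ) :=
    (Matrix.mulVecLin (U : Matrix (Fin N) (Fin N) ℂ)).restrictScalars ℝ
  have hf : ∀ y, f y = (U : Matrix (Fin N) (Fin N) ℂ).mulVec y := fun _ => rfl
  have hdet : LinearMap.det f ≠ 0 := by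
    let g : (Fin N → ℂ) →ₗ[ℝ] (Fin N → ℂ) :=
      (Matrix.mulVecLin ((U⁻¹ : Matrix.unitaryGroup (Fin N) ℂ) :
        Matrix (Fin N) (Fin N) ℂ)).restrictScalars ℝ
    have hfg : f * g = 1 := by
      refine LinearMap.ext fun y => ?_
      change (U : Matrix (Fin N) (Fin N) ℂ).mulVec
        (((U⁻¹ : Matrix.unitaryGroup (Fin N) ℂ) : Matrix (Fin N) (Fin N) ℂ).mulVec y) = y
      rw [Matrix.mulVec_mulVec, ← Submonoid.coe_mul]
      simp
    intro h0
    have := congrArg LinearMap.det hfg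
    rw [map_mul, h0] at this
    simp at this
  have key := Measure.addHaar_preimage_linearMap (volume : Measure (Fin N → ℂ)) hdet
  have hB := key {y | ∑ k, ‖y k‖ ^ 2 ≤ 1}
  have hpre : f ⁻¹' {y | ∑ k, ‖y k‖ ^ 2 ≤ 1} = {y | ∑ k, ‖y k‖ ^ 2 ≤ 1} := by
    ext y
    have := totalEnergy_mulVec U y
    simp only [totalEnergy] at this
    simp [hf, this]
  rw [hpre, volume_totalEnergy_le zero_le_one] at hB
  have h0 : ENNReal.ofReal ((Real.pi * 1) ^ Fintype.card (Fin N) / (Fintype.card (Fin N)).factorial) ≠ 0 := by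
    rw [Ne, ENNReal.ofReal_eq_zero, not_le]
    have := Real.pi_pos
    positivity
  have h1 : ENNReal.ofReal |(LinearMap.det f)⁻¹| = 1 := by
    have := ENNReal.mul_left_inj h0 ENNReal.ofReal_ne_top |>.1 ((one_mul _).trans hB)
    exact this.symm
  have := key S
  rw [h1, one_mul] at this
  exact this

/-- The probability that a Haar unitary moves a nonzero vector into a cone is the fraction of the
volume of a ball that lies in the cone. -/
theorem IsHaarDistributed.measure_cone_mul_volume {Ω : Type*} [MeasurableSpace Ω] {P : Measure Ω}
    [IsProbabilityMeasure P] {N : ℕ} {V : Ω → Matrix.unitaryGroup (Fin N) ℂ}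
    (hV : IsHaarDistributed P V) {C : Set (Fin N → ℂ)} (hC : MeasurableSet C)
    (hcone : ∀ c : ℝ, 0 < c → ∀ y, (c : ℂ) • y ∈ C ↔ y ∈ C) {x : Fin N → ℂ} (hx : x ≠ 0) (R : ℝ) :
    P {ω | (V ω : Matrix (Fin N) (Fin N) ℂ).mulVec x ∈ C} *
        volume {y : Fin N → ℂ | totalEnergy y ≤ R} =
      volume (C ∩ {y : Fin N → ℂ | totalEnergy y ≤ R}) := by
  set B : Set (Fin N → ℂ) := {y | totalEnergy y ≤ R}
  have : Nonempty (Fin N) := ⟨(Function.ne_iff.1 hx).choose⟩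
  have hjoint : Measurable fun p : Ω × (Fin N → ℂ) =>
      (V p.1 : Matrix (Fin N) (Fin N) ℂ).mulVec p.2 := by
    refine measurable_pi_lambda _ fun i => ?_
    simp only [Matrix.mulVec, dotProduct]
    refine Finset.measurable_fun_sum _ fun j _ => ?_
    refine Measurable.mul ?_ (by fun_prop)
    have : Measurable fun U : Matrix.unitaryGroup (Fin N) ℂ => (U : Matrix (Fin N) (Fin N) ℂ) i j :=
      Continuous.measurable (continuous_subtype_val.matrix_elem i j)
    exact this.comp (hV.measurable.comp measurable_fst)
  -- Fubini on `Ω × B`: for fixed `ω` the inner integral is the constant `volume (C ∩ B)` because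
  -- unitaries preserve volume and `B`; for fixed `y ≠ 0` it is the constant probability of the
  -- cone. The point `y = 0` is null.
  have h1 : ∀ ω, ∫⁻ y in B, C.indicator 1 ((V ω : Matrix (Fin N) (Fin N) ℂ).mulVec y) =
      volume (C ∩ B) := by
    intro ω
    have hmω : Measurable fun y : Fin N → ℂ => (V ω : Matrix (Fin N) (Fin N) ℂ).mulVec y :=
      Continuous.measurable (by fun_prop)
    rw [← volume_preimage_mulVec (V ω) (C ∩ B)]
    have : ∀ y, C.indicator (1 : (Fin N → ℂ) → ℝ≥0∞) ((V ω : Matrix (Fin N) (Fin N) ℂ).mulVec y) =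
        ((fun y : Fin N → ℂ => (V ω : Matrix (Fin N) (Fin N) ℂ).mulVec y) ⁻¹' C).indicator 1 y :=
      fun _ => rfl
    simp_rw [this]
    rw [lintegral_indicator_one (hmω hC), Measure.restrict_apply (hmω hC)]
    congr 1
    ext y
    simp [B, totalEnergy_mulVec]
  have h2 : ∫⁻ ω, (∫⁻ y in B, C.indicator 1 ((V ω : Matrix (Fin N) (Fin N) ℂ).mulVec y)) ∂P =
      volume (C ∩ B) := by
    simp [h1]
  rw [← h2, lintegral_lintegral_swap (by
    exact ((measurable_one.indicator hC).comp hjoint).aemeasurable)]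
  have h3 : ∀ᵐ y ∂(volume.restrict B),
      ∫⁻ ω, C.indicator 1 ((V ω : Matrix (Fin N) (Fin N) ℂ).mulVec y) ∂P =
        P {ω | (V ω : Matrix (Fin N) (Fin N) ℂ).mulVec x ∈ C} := by
    have hne : ∀ᵐ y ∂(volume : Measure (Fin N → ℂ)), y ≠ 0 := by
      simp [ae_iff]
    filter_upwards [ae_restrict_of_ae hne] with y hy
    rw [hV.measure_mulVec_mem_cone hC hcone hx hy]
    have hmy : Measurable fun ω => (V ω : Matrix (Fin N) (Fin N) ℂ).mulVec y :=
      hjoint.comp (measurable_id.prodMk measurable_const)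
    have : ∀ ω, C.indicator (1 : (Fin N → ℂ) → ℝ≥0∞) ((V ω : Matrix (Fin N) (Fin N) ℂ).mulVec y) =
        ((fun ω => (V ω : Matrix (Fin N) (Fin N) ℂ).mulVec y) ⁻¹' C).indicator 1 ω :=
      fun _ => rfl
    simp_rw [this]
    rw [lintegral_indicator_one (hmy hC)]
    rfl
  rw [lintegral_congr_ae h3]
  simp

/-! ### Sub-band sizes and probability bounds for sub-band energies. -/

/-- The number of frequencies in sub-band `m`. -/
def bandSize {N M : ℕ} (a : Fin N → Fin M) (m : Fin M) : ℕ := Fintype.card {k // a k = m}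

theorem sum_bandSize {N M : ℕ} (a : Fin N → Fin M) : ∑ m, bandSize a m = N := by
  have := Fintype.card_congr (Equiv.sigmaFiberEquiv a)
  rw [Fintype.card_sigma, Fintype.card_fin] at this
  exact this

theorem bandFraction_eq {N M : ℕ} (a : Fin N → Fin M) (m : Fin M) :
    bandFraction a m = bandSize a m / N := by
  rw [bandFraction, bandSize, Finset.sum_boole, Fintype.card_subtype]; ring

theorem bandSum_eq_sum_subtype {N M : ℕ} (a : Fin N → Fin M) (y : Fin N → ℂ) (m : Fin M) :
    bandSum a y m = ∑ k : {k // a k = m}, ‖y k‖ ^ 2 := by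
  rw [bandSum, ← Finset.sum_filter]
  exact (Finset.sum_subtype (p := fun k => a k = m) _ (by simp) fun k => ‖y k‖ ^ 2)

/-- The volume of a set that is given by separate conditions on the coordinates in every fibre
of `a` is a product. -/
theorem volume_forall_fiber {N M : ℕ} (a : Fin N → Fin M)
    (S : ∀ m : Fin M, Set ({k // a k = m} → ℂ)) (hS : ∀ m, MeasurableSet (S m)) :
    volume {y : Fin N → ℂ | ∀ m, (fun k : {k // a k = m} => y k) ∈ S m} = ∏ m, volume (S m) := by
  let g : (Fin N → ℂ) → (∀ m, {k // a k = m} → ℂ) := fun y m k => y k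
  let f : (∀ m, {k // a k = m} → ℂ) → (Fin N → ℂ) := fun z k => z (a k) ⟨k, rfl⟩
  have hf : Measurable f := by fun_prop
  have hg : Measurable g := by fun_prop
  have hgf : g ∘ f = id := by
    funext z m k
    obtain ⟨k, rfl⟩ := k
    rfl
  -- Product measures are determined by boxes, and regrouping the coordinates by fibre turns a box
  -- into a product of boxes.
  have hmap : (Measure.pi fun m : Fin M => (volume : Measure ({k // a k = m} → ℂ))).map f =
      volume := by
    refine (Measure.pi_eq (μ := fun _ : Fin N => (volume : Measure ℂ)) fun s hs => ?_).symm
    rw [Measure.map_apply hf (MeasurableSet.univ_pi hs)]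
    have : f ⁻¹' Set.univ.pi s =
        Set.univ.pi fun m => Set.univ.pi fun k : {k // a k = m} => s k := by
      ext z
      simp only [Set.mem_preimage, Set.mem_univ_pi, f]
      constructor
      · rintro h m ⟨k, rfl⟩
        exact h k
      · intro h k
        exact h (a k) ⟨k, rfl⟩
    rw [this, Measure.pi_pi]
    simp only [volume_pi, Measure.pi_pi]
    rw [← Fintype.prod_sigma' (fun (m : Fin M) (k : {k // a k = m}) => volume (s k))]
    exact Equiv.prod_comp (Equiv.sigmaFiberEquiv a) (fun k => volume (s k))
  have hset : {y : Fin N → ℂ | ∀ m, (fun k : {k // a k = m} => y k) ∈ S m} =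
      g ⁻¹' Set.univ.pi S := by
    ext y
    simp [g]
  rw [hset, ← hmap, Measure.map_apply hf (hg (MeasurableSet.univ_pi hS)), ← Set.preimage_comp, hgf,
    Set.preimage_id, Measure.pi_pi]

theorem volume_forall_bandSum_le {N M : ℕ} (a : Fin N → Fin M) (hn : ∀ m, 0 < bandSize a m)
    {R : Fin M → ℝ} (hR : ∀ m, 0 ≤ R m) :
    volume {y : Fin N → ℂ | ∀ m, bandSum a y m ≤ R m} =
      ENNReal.ofReal (∏ m, (Real.pi * R m) ^ bandSize a m / (bandSize a m).factorial) := by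
  have h := volume_forall_fiber a
    (fun m => {z : {k // a k = m} → ℂ | ∑ k, ‖z k‖ ^ 2 ≤ R m}) fun m =>
      measurableSet_le (by fun_prop) measurable_const
  simp only [Set.mem_ofPred_eq] at h
  simp only [bandSum_eq_sum_subtype]
  rw [h, ENNReal.ofReal_prod_of_nonneg fun m _ => by have := hR m; have := Real.pi_pos; positivity]
  refine Finset.prod_congr rfl fun m _ => ?_
  have : Nonempty {k // a k = m} := Fintype.card_pos_iff.1 (hn m)
  exact volume_totalEnergy_le (hR m)

/-- In `n ≥ 1` complex dimensions the ball of energy `(1 - η) R` takes up a fraction `(1 - η) ^ n ≤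
1 - η` of the ball of energy `R`, so the shell keeps at least the fraction `η`. The resulting loss
`η ^ M` does not depend on `N`. -/
theorem volume_forall_bandSum_mem_Ioc {N M : ℕ} (a : Fin N → Fin M) (hn : ∀ m, 0 < bandSize a m)
    {R : Fin M → ℝ} (hR : ∀ m, 0 ≤ R m) {η : ℝ} (h0 : 0 ≤ η) (h1 : η ≤ 1) :
    ENNReal.ofReal (η ^ M * ∏ m, (Real.pi * R m) ^ bandSize a m / (bandSize a m).factorial) ≤
      volume {y : Fin N → ℂ | ∀ m, bandSum a y m ∈ Set.Ioc ((1 - η) * R m) (R m)} := by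
  have h := volume_forall_fiber a
    (fun m => {z : {k // a k = m} → ℂ | ∑ k, ‖z k‖ ^ 2 ∈ Set.Ioc ((1 - η) * R m) (R m)}) fun m =>
      (show Measurable fun z : {k // a k = m} → ℂ => ∑ k, ‖z k‖ ^ 2 by fun_prop) measurableSet_Ioc
  simp only [Set.mem_ofPred_eq] at h
  simp only [bandSum_eq_sum_subtype]
  have hpi := Real.pi_pos
  have hprod : η ^ M * ∏ m, (Real.pi * R m) ^ bandSize a m / (bandSize a m).factorial =
      ∏ m, η * ((Real.pi * R m) ^ bandSize a m / (bandSize a m).factorial) := by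
    rw [Finset.prod_mul_distrib]; simp
  rw [h, hprod, ENNReal.ofReal_prod_of_nonneg fun m _ => by have := hR m; positivity]
  refine Finset.prod_le_prod' fun m _ => ?_
  have : Nonempty {k // a k = m} := Fintype.card_pos_iff.1 (hn m)
  have hRm := hR m
  have hR' : 0 ≤ (1 - η) * R m := mul_nonneg (by linarith) hRm
  have hdiff : {z : {k // a k = m} → ℂ | ∑ k, ‖z k‖ ^ 2 ∈ Set.Ioc ((1 - η) * R m) (R m)} =
      {z | ∑ k, ‖z k‖ ^ 2 ≤ R m} \ {z | ∑ k, ‖z k‖ ^ 2 ≤ (1 - η) * R m} := by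
    ext z
    simp [and_comm]
  rw [hdiff]
  refine le_trans ?_ le_measure_sdiff
  rw [volume_totalEnergy_le hRm, volume_totalEnergy_le hR', ← ENNReal.ofReal_sub _ (by positivity)]
  refine ENNReal.ofReal_le_ofReal ?_
  change η * ((Real.pi * R m) ^ bandSize a m / (bandSize a m).factorial) ≤
    (Real.pi * R m) ^ bandSize a m / (bandSize a m).factorial -
      (Real.pi * ((1 - η) * R m)) ^ bandSize a m / (bandSize a m).factorial
  have hpow : (1 - η) ^ bandSize a m ≤ 1 - η :=
    pow_le_of_le_one (by linarith) (by linarith) (hn m).ne'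
  rw [show Real.pi * ((1 - η) * R m) = (1 - η) * (Real.pi * R m) by ring, mul_pow (1 - η),
    mul_div_assoc ((1 - η) ^ _)]
  have hX : 0 ≤ (Real.pi * R m) ^ bandSize a m / (bandSize a m).factorial := by positivity
  nlinarith

/-- The multinomial weight `N! / ∏ m, n m ! * ∏ m, c m ^ n m`, with `n m` the sub-band sizes. -/
noncomputable def bandWeight {N M : ℕ} (a : Fin N → Fin M) (c : Fin M → ℝ) : ℝ :=
  N.factorial * ∏ m, c m ^ bandSize a m / (bandSize a m).factorial

theorem bandWeight_nonneg {N M : ℕ} (a : Fin N → Fin M) {c : Fin M → ℝ} (hc : ∀ m, 0 ≤ c m) :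
    0 ≤ bandWeight a c :=
  mul_nonneg (by positivity) (Finset.prod_nonneg fun m _ => by have := hc m; positivity)

theorem bandWeight_pos {N M : ℕ} (a : Fin N → Fin M) {c : Fin M → ℝ} (hc : ∀ m, 0 < c m) :
    0 < bandWeight a c :=
  mul_pos (by positivity) (Finset.prod_pos fun m _ => by have := hc m; positivity)

/-- Identifies `bandWeight` as the volume of a product of balls relative to the full ball of energy
`T`; the factors `π * T` cancel because the band sizes add up to `N`. -/
theorem bandWeight_mul_volume {N M : ℕ} (a : Fin N → Fin M) (R : Fin M → ℝ) {T : ℝ} (hT : 0 < T) :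
    bandWeight a (fun m => R m / T) * ((Real.pi * T) ^ N / N.factorial) =
      ∏ m, (Real.pi * R m) ^ bandSize a m / (bandSize a m).factorial := by
  have hpi := Real.pi_pos
  have h1 : (Real.pi * T) ^ N = ∏ m, (Real.pi * T) ^ bandSize a m := by
    rw [Finset.prod_pow_eq_pow_sum, sum_bandSize]
  calc bandWeight a (fun m => R m / T) * ((Real.pi * T) ^ N / N.factorial) =
      (Real.pi * T) ^ N * ∏ m, (R m / T) ^ bandSize a m / (bandSize a m).factorial := by
        rw [bandWeight]; field_simp
    _ = _ := by
        rw [h1, ← Finset.prod_mul_distrib]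
        refine Finset.prod_congr rfl fun m _ => ?_
        rw [← mul_div_assoc, ← mul_pow]
        congr 2
        field_simp

/-- Multiplying the constraints through by total energies makes them homogeneous, so the event is a
cone; inside the ball of energy `T` this cone lies in a product of balls. -/
theorem IsHaarDistributed.measure_forall_bandSum_le {Ω : Type*} [MeasurableSpace Ω] {P : Measure Ω}
    [IsProbabilityMeasure P] {N M : ℕ} {V : Ω → Matrix.unitaryGroup (Fin N) ℂ}
    (hV : IsHaarDistributed P V) (a : Fin N → Fin M) (hn : ∀ m, 0 < bandSize a m)
    {R : Fin M → ℝ} (hR : ∀ m, 0 ≤ R m) {x : Fin N → ℂ} (hx : x ≠ 0) :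
    P {ω | ∀ m, bandSum a ((V ω : Matrix (Fin N) (Fin N) ℂ).mulVec x) m ≤ R m} ≤
      ENNReal.ofReal (bandWeight a fun m => R m / totalEnergy x) := by
  have : Nonempty (Fin N) := ⟨(Function.ne_iff.1 hx).choose⟩
  have hT := totalEnergy_pos hx
  set T := totalEnergy x with hTdef
  let C : Set (Fin N → ℂ) := {y | ∀ m, T * bandSum a y m ≤ R m * totalEnergy y}
  have hC : MeasurableSet C := by
    have : C = ⋂ m, {y | T * bandSum a y m ≤ R m * totalEnergy y} := by ext; simp [C]
    rw [this]
    exact MeasurableSet.iInter fun m => measurableSet_le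
      ((measurable_bandSum a m).const_mul T) (measurable_totalEnergy.const_mul (R m))
  have hcone : ∀ c : ℝ, 0 < c → ∀ y, (c : ℂ) • y ∈ C ↔ y ∈ C := by
    intro c hc y
    simp only [C, Set.mem_ofPred_eq, bandSum_smul, totalEnergy_smul]
    refine forall_congr' fun m => ?_
    rw [mul_left_comm T, mul_left_comm (R m)]
    exact mul_le_mul_iff_right₀ (by positivity)
  have hset : {ω | ∀ m, bandSum a ((V ω : Matrix (Fin N) (Fin N) ℂ).mulVec x) m ≤ R m} =
      {ω | (V ω : Matrix (Fin N) (Fin N) ℂ).mulVec x ∈ C} := by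
    ext ω
    simp only [C, Set.mem_ofPred_eq, totalEnergy_mulVec, ← hTdef]
    refine forall_congr' fun m => ?_
    rw [mul_comm T]
    exact (mul_le_mul_iff_left₀ hT).symm
  have hsub : C ∩ {y | totalEnergy y ≤ T} ⊆ {y | ∀ m, bandSum a y m ≤ R m} := by
    rintro y ⟨hy, hyT⟩ m
    have h1 : T * bandSum a y m ≤ R m * totalEnergy y := hy m
    have h2 : R m * totalEnergy y ≤ R m * T := mul_le_mul_of_nonneg_left hyT (hR m)
    exact le_of_mul_le_mul_left (h1.trans (h2.trans_eq (mul_comm _ _))) hT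
  have hpi := Real.pi_pos
  have hball : volume {y : Fin N → ℂ | totalEnergy y ≤ T} =
      ENNReal.ofReal ((Real.pi * T) ^ N / N.factorial) := by
    simpa [totalEnergy] using volume_totalEnergy_le (ι := Fin N) hT.le
  have hpos : 0 < (Real.pi * T) ^ N / (N.factorial : ℝ) := by positivity
  have key := (hV.measure_cone_mul_volume hC hcone hx T).trans_le (measure_mono hsub)
  rw [hball, volume_forall_bandSum_le a hn hR, ← bandWeight_mul_volume a R hT,
    ENNReal.ofReal_mul (bandWeight_nonneg a fun m => div_nonneg (hR m) hT.le)] at key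
  rw [hset]
  exact (ENNReal.mul_le_mul_iff_left (by simpa using hpos) ENNReal.ofReal_ne_top).1 key

/-- On the product of shells of energies `r m` the total energy lies between `(1 - η) * S` and `S`.
Relative band energies there are within factors `1 - η` and `(1 - η)⁻¹` of `r m / S`, which dictates
the window. -/
theorem IsHaarDistributed.le_measure_forall_bandSum_mem {Ω : Type*} [MeasurableSpace Ω]
    {P : Measure Ω} [IsProbabilityMeasure P] {N M : ℕ} {V : Ω → Matrix.unitaryGroup (Fin N) ℂ}
    (hV : IsHaarDistributed P V) (a : Fin N → Fin M) (hn : ∀ m, 0 < bandSize a m)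
    {r : Fin M → ℝ} (hr : ∀ m, 0 < r m) {x : Fin N → ℂ} (hx : x ≠ 0) {η : ℝ} (h0 : 0 ≤ η)
    (h1 : η < 1) :
    ENNReal.ofReal (η ^ M * bandWeight a fun m => r m / ∑ j, r j) ≤
      P {ω | ∀ m, bandSum a ((V ω : Matrix (Fin N) (Fin N) ℂ).mulVec x) m ∈
        Set.Icc ((1 - η) * (r m / ∑ j, r j) * totalEnergy x)
          ((1 - η)⁻¹ * (r m / ∑ j, r j) * totalEnergy x)} := by
  obtain ⟨k, -⟩ := Function.ne_iff.1 hx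
  have : Nonempty (Fin N) := ⟨k⟩
  have hT := totalEnergy_pos hx
  have hS : 0 < ∑ j, r j := Finset.sum_pos (fun m _ => hr m) ⟨a k, Finset.mem_univ _⟩
  set S := ∑ j, r j with hSdef
  have hη : 0 < 1 - η := by linarith
  let C : Set (Fin N → ℂ) := {y | ∀ m, (1 - η) * (r m / S) * totalEnergy y ≤ bandSum a y m ∧
    bandSum a y m ≤ (1 - η)⁻¹ * (r m / S) * totalEnergy y}
  have hC : MeasurableSet C := by
    have : C = ⋂ m, ({y | (1 - η) * (r m / S) * totalEnergy y ≤ bandSum a y m} ∩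
        {y | bandSum a y m ≤ (1 - η)⁻¹ * (r m / S) * totalEnergy y}) := by ext; simp [C]
    rw [this]
    exact MeasurableSet.iInter fun m =>
      (measurableSet_le (measurable_totalEnergy.const_mul _) (measurable_bandSum a m)).inter
        (measurableSet_le (measurable_bandSum a m) (measurable_totalEnergy.const_mul _))
  have hcone : ∀ c : ℝ, 0 < c → ∀ y, (c : ℂ) • y ∈ C ↔ y ∈ C := by
    intro c hc y
    simp only [C, Set.mem_ofPred_eq, bandSum_smul, totalEnergy_smul]
    refine forall_congr' fun m => and_congr ?_ ?_
    all_goals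
      rw [mul_left_comm]
      exact mul_le_mul_iff_right₀ (by positivity)
  have hset : {ω | ∀ m, bandSum a ((V ω : Matrix (Fin N) (Fin N) ℂ).mulVec x) m ∈
        Set.Icc ((1 - η) * (r m / S) * totalEnergy x) ((1 - η)⁻¹ * (r m / S) * totalEnergy x)} =
      {ω | (V ω : Matrix (Fin N) (Fin N) ℂ).mulVec x ∈ C} := by
    ext ω
    simp only [C, Set.mem_ofPred_eq, totalEnergy_mulVec, Set.mem_Icc]
  have hsub : {y : Fin N → ℂ | ∀ m, bandSum a y m ∈ Set.Ioc ((1 - η) * r m) (r m)} ⊆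
      C ∩ {y | totalEnergy y ≤ S} := by
    intro y hy
    have hyS : totalEnergy y ≤ S := by
      rw [← sum_bandSum a y]
      exact Finset.sum_le_sum fun m _ => (hy m).2
    have hyS' : (1 - η) * S ≤ totalEnergy y := by
      rw [← sum_bandSum a y, hSdef, Finset.mul_sum]
      exact Finset.sum_le_sum fun m _ => (hy m).1.le
    refine ⟨fun m => ⟨le_trans ?_ (hy m).1.le, (hy m).2.trans ?_⟩, hyS⟩
    · have hrm := hr m
      calc (1 - η) * (r m / S) * totalEnergy y ≤ (1 - η) * (r m / S) * S := by gcongr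
        _ = (1 - η) * r m := by field_simp
    · have hrm := hr m
      calc r m = (1 - η)⁻¹ * (r m / S) * ((1 - η) * S) := by field_simp
        _ ≤ _ := by gcongr
  have hpi := Real.pi_pos
  have hball : volume {y : Fin N → ℂ | totalEnergy y ≤ S} =
      ENNReal.ofReal ((Real.pi * S) ^ N / N.factorial) := by
    simpa [totalEnergy] using volume_totalEnergy_le (ι := Fin N) hS.le
  have hpos : 0 < (Real.pi * S) ^ N / (N.factorial : ℝ) := by positivity
  have key := ((volume_forall_bandSum_mem_Ioc a hn (fun m => (hr m).le) h0 h1.le).trans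
    (measure_mono hsub)).trans_eq (hV.measure_cone_mul_volume hC hcone hx S).symm
  rw [hball, ← bandWeight_mul_volume a r hS, ← mul_assoc, ENNReal.ofReal_mul (mul_nonneg
    (by positivity) (bandWeight_nonneg a fun m => div_nonneg (hr m).le hS.le))] at key
  rw [hset]
  exact (ENNReal.mul_le_mul_iff_left (by simpa using hpos) ENNReal.ofReal_ne_top).1 key

/-! ### Stirling asymptotics of the multinomial weight. -/

/-- The error term of `log n! ≈ n log n - n`. -/
noncomputable def logFactorialError (n : ℕ) : ℝ := Real.log n.factorial - (n * Real.log n - n)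

/-- The error is `log (stirlingSeq n) + log (2 * n) / 2`: a convergent term plus a logarithm, both
`o(n)`. -/
theorem tendsto_logFactorialError_div :
    Tendsto (fun n : ℕ => logFactorialError n / n) atTop (𝓝 0) := by
  have h1 : Tendsto (fun n : ℕ => Real.log (Stirling.stirlingSeq n) / n) atTop (𝓝 0) :=
    ((Stirling.tendsto_stirlingSeq_sqrt_pi.log (by have := Real.pi_pos; positivity)).div_atTop
      tendsto_natCast_atTop_atTop)
  have h2 : Tendsto (fun n : ℕ => Real.log (2 * n) / n) atTop (𝓝 0) := by
    have h3 : Tendsto (fun x : ℝ => 2 * (Real.log x / x)) atTop (𝓝 (2 * 0)) :=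
      ((Real.isLittleO_log_id_atTop).tendsto_div_nhds_zero).const_mul 2
    rw [mul_zero] at h3
    have h4 : Tendsto (fun n : ℕ => 2 * (n : ℝ)) atTop atTop :=
      tendsto_natCast_atTop_atTop.const_mul_atTop two_pos
    refine (h3.comp h4).congr fun n => ?_
    simp only [Function.comp]
    rcases eq_or_ne n 0 with rfl | hn
    · simp
    · field_simp
  have h := h1.add (h2.const_mul (1 / 2))
  simp only [mul_zero, add_zero] at h
  refine h.congr' ?_
  filter_upwards [eventually_gt_atTop 0] with n hn
  have hn' : (n : ℝ) ≠ 0 := by positivity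
  rw [Stirling.log_stirlingSeq_formula, logFactorialError, Real.log_div hn' (Real.exp_ne_zero _),
    Real.log_exp]
  field_simp
  ring

section bandWeight

variable {M : ℕ} {a : ∀ N : ℕ, Fin N → Fin M} {δ : Fin M → ℝ}

theorem eventually_forall_bandSize_pos (hδ : ∀ m, 0 < δ m)
    (ha : ∀ m, Tendsto (fun N => bandFraction (a N) m) atTop (𝓝 (δ m))) :
    ∀ᶠ N in atTop, ∀ m, 0 < bandSize (a N) m := by
  rw [eventually_all]
  intro m
  filter_upwards [(ha m).eventually (lt_mem_nhds (hδ m))] with N hN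
  rw [bandFraction_eq] at hN
  by_contra h
  simp [Nat.eq_zero_of_not_pos h] at hN

theorem sum_eq_one_of_tendsto_bandFraction
    (ha : ∀ m, Tendsto (fun N => bandFraction (a N) m) atTop (𝓝 (δ m))) : ∑ m, δ m = 1 := by
  have h : Tendsto (fun N => ∑ m, bandFraction (a N) m) atTop (𝓝 (∑ m, δ m)) :=
    tendsto_finsetSum _ fun m _ => ha m
  refine tendsto_nhds_unique h (tendsto_const_nhds.congr' ?_)
  filter_upwards [eventually_gt_atTop 0] with N hN
  simp only [bandFraction_eq, ← Finset.sum_div, ← Nat.cast_sum, sum_bandSize]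
  rw [div_self (by positivity)]

theorem tendsto_bandSize_atTop (hδ : ∀ m, 0 < δ m)
    (ha : ∀ m, Tendsto (fun N => bandFraction (a N) m) atTop (𝓝 (δ m))) (m : Fin M) :
    Tendsto (fun N => bandSize (a N) m) atTop atTop := by
  rw [← tendsto_natCast_atTop_iff (R := ℝ)]
  refine ((ha m).pos_mul_atTop (hδ m) tendsto_natCast_atTop_atTop).congr' ?_
  filter_upwards [eventually_gt_atTop 0] with N hN
  rw [bandFraction_eq]
  field_simp

/-- The limit is `-D(δ ‖ c)` written out. Since each `δ m` is positive, every band size tends to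
infinity and all Stirling errors are `o(N)`. -/
theorem tendsto_log_bandWeight (hδ : ∀ m, 0 < δ m)
    (ha : ∀ m, Tendsto (fun N => bandFraction (a N) m) atTop (𝓝 (δ m)))
    {c : Fin M → ℝ} (hc : ∀ m, 0 < c m) :
    Tendsto (fun N : ℕ => Real.log (bandWeight (a N) c) / N) atTop
      (𝓝 (∑ m, (Real.negMulLog (δ m) + δ m * Real.log (c m)))) := by
  have h1 : ∀ m, Tendsto (fun N => Real.negMulLog (bandFraction (a N) m) +
      bandFraction (a N) m * Real.log (c m) -
        bandFraction (a N) m * (logFactorialError (bandSize (a N) m) / bandSize (a N) m)) atTop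
      (𝓝 (Real.negMulLog (δ m) + δ m * Real.log (c m) - δ m * 0)) := fun m =>
    (((Real.continuous_negMulLog.tendsto _).comp (ha m)).add ((ha m).mul_const _)).sub
      ((ha m).mul (tendsto_logFactorialError_div.comp (tendsto_bandSize_atTop hδ ha m)))
  have h2 := tendsto_logFactorialError_div.add
    (tendsto_finsetSum Finset.univ fun m _ => h1 m)
  simp only [mul_zero, sub_zero, zero_add] at h2
  refine h2.congr' ?_
  filter_upwards [eventually_gt_atTop 0, eventually_forall_bandSize_pos hδ ha] with N hN hn
  have hN' : (N : ℝ) ≠ 0 := by positivity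
  have hsum : (∑ m, (bandSize (a N) m : ℝ)) = N := by rw [← Nat.cast_sum, sum_bandSize]
  have hlog : Real.log (bandWeight (a N) c) = Real.log N.factorial +
      ∑ m, (bandSize (a N) m * Real.log (c m) - Real.log (bandSize (a N) m).factorial) := by
    rw [bandWeight, Real.log_mul (by positivity)
      (Finset.prod_ne_zero_iff.2 fun m _ => by have := hc m; positivity),
      Real.log_prod fun m _ => by have := hc m; positivity]
    congr 1
    refine Finset.sum_congr rfl fun m _ => ?_
    rw [Real.log_div (by have := hc m; positivity) (by positivity), Real.log_pow]
  -- The main part `N log N - N` of `log N!` is distributed over the bands, band `m` receiving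
  -- `bandSize * (log N - 1)`.
  have hterm : ∀ m, Real.negMulLog (bandFraction (a N) m) +
      bandFraction (a N) m * Real.log (c m) -
        bandFraction (a N) m * (logFactorialError (bandSize (a N) m) / bandSize (a N) m) =
      (bandSize (a N) m * Real.log (c m) - Real.log (bandSize (a N) m).factorial +
        bandSize (a N) m * (Real.log N - 1)) / N := by
    intro m
    have hm : (bandSize (a N) m : ℝ) ≠ 0 := by have := hn m; positivity
    rw [bandFraction_eq, Real.negMulLog, Real.log_div hm hN', logFactorialError]
    field_simp
    ring
  rw [Finset.sum_congr rfl fun m _ => hterm m, ← Finset.sum_div, Finset.sum_add_distrib,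
    ← Finset.sum_mul, hsum, hlog, logFactorialError]
  field_simp
  ring

end bandWeight

/-! ### Counting sequences by empirical distribution. -/

/-- The empirical distribution of a sequence. -/
noncomputable def empirical {A : Finset ℂ} {N : ℕ} (x : Fin N → A) (α : A) : ℝ :=
  (∑ k, if x k = α then (1 : ℝ) else 0) / N

section counting

variable {A : Finset ℂ}

theorem sum_empirical_mul {N : ℕ} (x : Fin N → A) (f : A → ℝ) :
    ∑ α, empirical x α * f α = (∑ k, f (x k)) / N := by
  simp only [empirical, div_mul_eq_mul_div, ← Finset.sum_div, Finset.sum_mul]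
  rw [Finset.sum_comm]
  simp

theorem empirical_mem_stdSimplex {N : ℕ} (hN : 0 < N) (x : Fin N → A) :
    empirical x ∈ stdSimplex ℝ A := by
  refine ⟨fun α => div_nonneg (Finset.sum_nonneg fun k _ => by split_ifs <;> simp) (by simp), ?_⟩
  have := sum_empirical_mul x fun _ => 1
  have hN' : (N : ℝ) ≠ 0 := by positivity
  simpa [hN'] using this

theorem sum_prod_eq_one {p : A → ℝ} (hp : ∑ α, p α = 1) (N : ℕ) :
    ∑ x : Fin N → A, ∏ k, p (x k) = 1 := by
  rw [← Fintype.sum_pow, hp, one_pow]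

-- Under the i.i.d. law `q` each counted sequence has probability at least `exp (-(N * h))`, and the
-- total mass is 1.
open Classical in
theorem card_crossEntropy_le {q : A → ℝ} (hq : ∀ α, 0 < q α) (hq1 : ∑ α, q α = 1) {N : ℕ}
    (hN : 0 < N) (h : ℝ) :
    ((Finset.univ.filter fun x : Fin N → A =>
      ∑ α, empirical x α * -Real.log (q α) ≤ h).card : ℝ) ≤ Real.exp (N * h) := by
  set S := Finset.univ.filter fun x : Fin N → A => ∑ α, empirical x α * -Real.log (q α) ≤ h
  have hN' : (0 : ℝ) < N := by positivity
  have h1 : ∀ x ∈ S, Real.exp (-(N * h)) ≤ ∏ k, q (x k) := by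
    intro x hx
    have hx' := (Finset.mem_filter.1 hx).2
    rw [sum_empirical_mul x fun α => -Real.log (q α), div_le_iff₀ hN', Finset.sum_neg_distrib] at hx'
    rw [← Real.exp_log (Finset.prod_pos fun k _ => hq (x k)), Real.exp_le_exp,
      Real.log_prod fun k _ => (hq (x k)).ne']
    linarith
  have h2 : S.card * Real.exp (-(N * h)) ≤ 1 := by
    rw [← nsmul_eq_mul, ← sum_prod_eq_one hq1 N]
    exact (Finset.card_nsmul_le_sum S _ _ h1).trans (Finset.sum_le_sum_of_subset_of_nonneg
      (Finset.subset_univ S) fun x _ _ => Finset.prod_nonneg fun k _ => (hq _).le)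
  rwa [Real.exp_neg, ← div_eq_mul_inv, div_le_one (Real.exp_pos _)] at h2

-- Chernoff bound. The moment generating function of `g - b` is 1 at 0 with negative derivative, so
-- it drops below 1 at some `l > 0`; its value there is `ρ`.
open Classical in
theorem exists_chernoff {p : A → ℝ} (hp : ∀ α, 0 ≤ p α) (hp1 : ∑ α, p α = 1) {g : A → ℝ}
    {b : ℝ} (hb : ∑ α, p α * g α < b) :
    ∃ ρ : ℝ, 0 ≤ ρ ∧ ρ < 1 ∧ ∀ N : ℕ, 0 < N →
      ∑ x : Fin N → A with b ≤ ∑ α, empirical x α * g α, ∏ k, p (x k) ≤ ρ ^ N := by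
  have hder : HasDerivAt (fun l : ℝ => ∑ α, p α * Real.exp (l * (g α - b)))
      (∑ α, p α * (g α - b)) 0 := by
    have : ∀ α : A, HasDerivAt (fun l : ℝ => p α * Real.exp (l * (g α - b)))
        (p α * (g α - b)) 0 := fun α => by
      have := (((hasDerivAt_id (0 : ℝ)).mul_const (g α - b)).exp).const_mul (p α)
      simpa using this
    exact HasDerivAt.fun_sum fun α _ => this α
  have hneg : ∑ α, p α * (g α - b) < 0 := by
    simp only [mul_sub, Finset.sum_sub_distrib, ← Finset.sum_mul, hp1]
    linarith
  obtain ⟨l, hl, hl0⟩ : ∃ l : ℝ, ∑ α, p α * Real.exp (l * (g α - b)) < 1 ∧ 0 < l := by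
    have h1 := (hder.tendsto_slope.mono_left (nhdsGT_le_nhdsNE 0)).eventually_lt_const hneg
    obtain ⟨l, hl, hl0⟩ := (h1.and self_mem_nhdsWithin).exists
    have hl0 : 0 < l := hl0
    refine ⟨l, ?_, hl0⟩
    rw [slope_def_field, sub_zero, div_lt_iff₀ hl0, zero_mul] at hl
    simp only [zero_mul, Real.exp_zero, mul_one, hp1] at hl
    linarith
  refine ⟨∑ α, p α * Real.exp (l * (g α - b)), Finset.sum_nonneg fun α _ =>
    mul_nonneg (hp α) (Real.exp_pos _).le, hl, fun N hN => ?_⟩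
  have hN' : (0 : ℝ) < N := by positivity
  rw [Fintype.sum_pow]
  have hnn : ∀ x : Fin N → A, 0 ≤ ∏ k, p (x k) * Real.exp (l * (g (x k) - b)) := fun x =>
    Finset.prod_nonneg fun k _ => mul_nonneg (hp _) (Real.exp_pos _).le
  refine le_trans (Finset.sum_le_sum fun x hx => ?_)
    (Finset.sum_le_sum_of_subset_of_nonneg (Finset.subset_univ _) fun x _ _ => hnn x)
  have hx' := (Finset.mem_filter.1 hx).2
  rw [sum_empirical_mul, le_div_iff₀ hN'] at hx'
  rw [Finset.prod_mul_distrib, ← Real.exp_sum]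
  refine le_mul_of_one_le_right (Finset.prod_nonneg fun k _ => hp _) (Real.one_le_exp ?_)
  rw [← Finset.mul_sum]
  refine mul_nonneg hl0.le ?_
  simp only [Finset.sum_sub_distrib, Finset.sum_const, Finset.card_univ, Fintype.card_fin,
    nsmul_eq_mul]
  linarith

open Classical in
/-- The number of sequences whose average of `f` is close to its `p`-mean is at least of order
`exp (N H(p))`. -/
theorem eventually_le_card_typical {p : A → ℝ} (hp : ∀ α, 0 < p α) (hp1 : ∑ α, p α = 1)
    (f : A → ℝ) {η : ℝ} (hη : 0 < η) :
    ∀ᶠ N : ℕ in atTop, 1 / 2 * Real.exp (N * (shannonEntropy p - η)) ≤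
      ((Finset.univ.filter fun x : Fin N → A =>
        |∑ α, empirical x α * f α - ∑ α, p α * f α| < η).card : ℝ) := by
  have hp0 : ∀ α, 0 ≤ p α := fun α => (hp α).le
  -- Three Chernoff bounds discard vanishing mass: average of `f` too large, too small, and
  -- probability of the sequence too large. The remaining mass is at least `1 / 2`, and each
  -- remaining sequence has probability at most `exp (-(N * (H(p) - η)))`.
  obtain ⟨ρ₁, h10, h11, h1⟩ := exists_chernoff hp0 hp1 (g := f) (b := ∑ α, p α * f α + η)
    (by linarith)
  obtain ⟨ρ₂, h20, h21, h2⟩ := exists_chernoff hp0 hp1 (g := fun α => -f α)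
    (b := -∑ α, p α * f α + η) (by simp only [mul_neg, Finset.sum_neg_distrib]; linarith)
  obtain ⟨ρ₃, h30, h31, h3⟩ := exists_chernoff hp0 hp1 (g := fun α => Real.log (p α))
    (b := ∑ α, p α * Real.log (p α) + η) (by linarith)
  have hlim : Tendsto (fun N : ℕ => ρ₁ ^ N + ρ₂ ^ N + ρ₃ ^ N) atTop (𝓝 (0 + 0 + 0)) :=
    ((tendsto_pow_atTop_nhds_zero_of_lt_one h10 h11).add
      (tendsto_pow_atTop_nhds_zero_of_lt_one h20 h21)).add
      (tendsto_pow_atTop_nhds_zero_of_lt_one h30 h31)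
  filter_upwards [hlim.eventually_lt_const (show (0 : ℝ) + 0 + 0 < 1 / 2 by norm_num),
    eventually_gt_atTop 0] with N hN hN0
  have hN' : (0 : ℝ) < N := by positivity
  set G := Finset.univ.filter fun x : Fin N → A =>
        |∑ α, empirical x α * f α - ∑ α, p α * f α| < η
  set S₁ := Finset.univ.filter fun x : Fin N → A => ∑ α, p α * f α + η ≤ ∑ α, empirical x α * f α
  set S₂ := Finset.univ.filter fun x : Fin N → A =>
    -∑ α, p α * f α + η ≤ ∑ α, empirical x α * -f α
  set S₃ := Finset.univ.filter fun x : Fin N → A =>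
    ∑ α, p α * Real.log (p α) + η ≤ ∑ α, empirical x α * Real.log (p α)
  have hw : ∀ x : Fin N → A, 0 ≤ ∏ k, p (x k) := fun x => Finset.prod_nonneg fun k _ => hp0 _
  have hcover : (Finset.univ : Finset (Fin N → A)) ⊆ (S₁ ∪ S₂ ∪ S₃) ∪ (G \ S₃) := by
    intro x _
    simp only [Finset.mem_union, Finset.mem_sdiff, S₁, S₂, S₃, G, Finset.mem_filter,
      Finset.mem_univ, true_and, mul_neg, Finset.sum_neg_distrib, abs_lt]
    by_contra hcon
    push Not at hcon
    obtain ⟨⟨⟨c1, c2⟩, c3⟩, c4⟩ := hcon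
    have := c4 ⟨by linarith, by linarith⟩
    linarith
  have hsum : 1 ≤ (∑ x ∈ S₁, ∏ k, p (x k) + ∑ x ∈ S₂, ∏ k, p (x k) + ∑ x ∈ S₃, ∏ k, p (x k)) +
      ∑ x ∈ G \ S₃, ∏ k, p (x k) := by
    have hU : ∀ S T : Finset (Fin N → A), ∑ x ∈ S ∪ T, ∏ k, p (x k) ≤
        ∑ x ∈ S, ∏ k, p (x k) + ∑ x ∈ T, ∏ k, p (x k) := fun S T => by
      rw [← Finset.sum_union_inter]
      exact le_add_of_nonneg_right (Finset.sum_nonneg fun x _ => hw x)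
    rw [← sum_prod_eq_one hp1 N]
    refine (Finset.sum_le_sum_of_subset_of_nonneg hcover fun x _ _ => hw x).trans ?_
    have a1 := hU (S₁ ∪ S₂ ∪ S₃) (G \ S₃)
    have a2 := hU (S₁ ∪ S₂) S₃
    have a3 := hU S₁ S₂
    linarith
  have hhalf : 1 / 2 ≤ ∑ x ∈ G \ S₃, ∏ k, p (x k) := by
    have b1 := h1 N hN0
    have b2 := h2 N hN0
    have b3 := h3 N hN0
    linarith
  have hH : ∑ α, p α * Real.log (p α) = -shannonEntropy p := by
    simp [shannonEntropy, Real.negMulLog]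
  have hle : ∑ x ∈ G \ S₃, ∏ k, p (x k) ≤ G.card * Real.exp (-(N * (shannonEntropy p - η))) := by
    refine (Finset.sum_le_card_nsmul _ _ (Real.exp (-(N * (shannonEntropy p - η)))) ?_).trans ?_
    · intro x hx
      have hx' := (Finset.mem_sdiff.1 hx).2
      simp only [S₃, Finset.mem_filter, Finset.mem_univ, true_and, not_le] at hx'
      rw [sum_empirical_mul x fun α => Real.log (p α), hH, div_lt_iff₀ hN'] at hx'
      rw [← Real.exp_log (Finset.prod_pos fun k _ => hp (x k)), Real.exp_le_exp,
        Real.log_prod fun k _ => (hp (x k)).ne']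
      linarith
    · rw [nsmul_eq_mul]
      have : (G \ S₃).card ≤ G.card := Finset.card_le_card Finset.sdiff_subset
      gcongr
  have := hhalf.trans hle
  rwa [Real.exp_neg, ← div_eq_mul_inv, le_div_iff₀ (Real.exp_pos _)] at this

end counting

/-! ### Expected counts of pairs of empirical distribution and band energies. -/

/-- The mean energy of a distribution on `A`. -/
noncomputable def meanEnergy {A : Finset ℂ} (p : A → ℝ) : ℝ := ∑ α : A, p α * ‖(α : ℂ)‖ ^ 2

/-- The exponential rate of the expected number of sequences with empirical distribution `p` and
sub-band energies `φ`. -/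
noncomputable def pairRate {A : Finset ℂ} {M : ℕ} (δ : Fin M → ℝ) (p : A → ℝ) (φ : Fin M → ℝ) : ℝ :=
  shannonEntropy p + ∑ m, (Real.negMulLog (δ m) + δ m * Real.log (φ m / ∑ j, φ j))

/-- The pairs of a distribution on `A` and sub-band energies in `[s m - ε, s m]` with the same total
energy. -/
def feasiblePairs {M : ℕ} (A : Finset ℂ) (s : Fin M → ℝ) (ε : ℝ) :
    Set ((A → ℝ) × (Fin M → ℝ)) :=
  {z | z.1 ∈ stdSimplex ℝ A ∧ (∀ m, z.2 m ∈ Set.Icc (s m - ε) (s m)) ∧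
    meanEnergy z.1 = ∑ m, z.2 m}

/-- The expected number of sequences in `A ^ N` whose empirical distribution and sub-band energies
form a pair in `S`. -/
noncomputable def expectedCount {Ω : Type*} [MeasurableSpace Ω] (P : Measure Ω) {N M : ℕ}
    {A : Finset ℂ} (a : Fin N → Fin M) (V : Ω → Matrix.unitaryGroup (Fin N) ℂ)
    (S : Set ((A → ℝ) × (Fin M → ℝ))) : ℝ≥0∞ :=
  ∑ x : Fin N → A, P {ω | (empirical x, bandEnergy a ((V ω : Matrix (Fin N) (Fin N) ℂ).mulVec
    fun k => (x k : ℂ))) ∈ S}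

section expectedCount

variable {Ω : Type*} [MeasurableSpace Ω] {P : Measure Ω} {N M : ℕ} {A : Finset ℂ}
  {a : Fin N → Fin M} {V : Ω → Matrix.unitaryGroup (Fin N) ℂ}

theorem meanEnergy_empirical (x : Fin N → A) :
    meanEnergy (empirical x) = totalEnergy (fun k => (x k : ℂ)) / N :=
  sum_empirical_mul x fun α => ‖(α : ℂ)‖ ^ 2

theorem sum_bandEnergy_mulVec (a : Fin N → Fin M) (U : Matrix.unitaryGroup (Fin N) ℂ)
    (x : Fin N → A) :
    ∑ m, bandEnergy a ((U : Matrix (Fin N) (Fin N) ℂ).mulVec fun k => (x k : ℂ)) m =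
      meanEnergy (empirical x) := by
  simp only [bandEnergy_eq, ← Finset.sum_div, sum_bandSum, totalEnergy_mulVec, meanEnergy_empirical]

theorem expectedCount_mono {S T : Set ((A → ℝ) × (Fin M → ℝ))} (h : S ⊆ T) :
    expectedCount P a V S ≤ expectedCount P a V T :=
  Finset.sum_le_sum fun _ _ => measure_mono fun _ hω => h hω

/-- Monotonicity and subadditivity hold for arbitrary sets of pairs, measurable or not; they are
what induction over a compact set needs. -/
theorem expectedCount_union_le (S T : Set ((A → ℝ) × (Fin M → ℝ))) :
    expectedCount P a V (S ∪ T) ≤ expectedCount P a V S + expectedCount P a V T := by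
  rw [expectedCount, expectedCount, expectedCount, ← Finset.sum_add_distrib]
  exact Finset.sum_le_sum fun _ _ => measure_union_le _ _

/-- Conservation of energy under a unitary: pairs violating it never occur. -/
theorem expectedCount_eq_zero {S : Set ((A → ℝ) × (Fin M → ℝ))}
    (h : ∀ z ∈ S, meanEnergy z.1 ≠ ∑ m, z.2 m) : expectedCount P a V S = 0 := by
  refine Finset.sum_eq_zero fun x _ => ?_
  convert measure_empty (μ := P)
  rw [Set.eq_empty_iff_forall_notMem]
  intro ω hω
  exact h _ hω (sum_bandEnergy_mulVec a (V ω) x).symm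

theorem measurable_bandEnergy_mulVec (hV : Measurable V) (a : Fin N → Fin M) (x : Fin N → ℂ)
    (m : Fin M) :
    Measurable fun ω => bandEnergy a ((V ω : Matrix (Fin N) (Fin N) ℂ).mulVec x) m := by
  have : Measurable fun U : Matrix.unitaryGroup (Fin N) ℂ =>
      (U : Matrix (Fin N) (Fin N) ℂ).mulVec x :=
    Continuous.measurable (by fun_prop)
  simp only [bandEnergy_eq]
  exact ((measurable_bandSum a m).comp (this.comp hV)).div_const _

theorem lintegral_card_admissibleSeqs (hV : Measurable V) (a : Fin N → Fin M) (s : Fin M → ℝ)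
    (ε : ℝ) :
    ∫⁻ ω, ((admissibleSeqs A a s (V ω : Matrix (Fin N) (Fin N) ℂ) ε).card : ℝ≥0∞) ∂P =
      ∑ x : Fin N → A, P {ω | ∀ m, bandEnergy a ((V ω : Matrix (Fin N) (Fin N) ℂ).mulVec
        fun k => (x k : ℂ)) m ∈ Set.Icc (s m - ε) (s m)} := by
  classical
  set E : (Fin N → A) → Set Ω := fun x => {ω | ∀ m, bandEnergy a
    ((V ω : Matrix (Fin N) (Fin N) ℂ).mulVec fun k => (x k : ℂ)) m ∈ Set.Icc (s m - ε) (s m)}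
  have hmeas : ∀ x, MeasurableSet (E x) := by
    intro x
    have : E x = ⋂ m, (fun ω => bandEnergy a ((V ω : Matrix (Fin N) (Fin N) ℂ).mulVec
        fun k => (x k : ℂ)) m) ⁻¹' Set.Icc (s m - ε) (s m) := by
      ext; simp [E]
    rw [this]
    exact MeasurableSet.iInter fun m => measurable_bandEnergy_mulVec hV a _ m measurableSet_Icc
  have hcard : ∀ ω, ((admissibleSeqs A a s (V ω : Matrix (Fin N) (Fin N) ℂ) ε).card : ℝ≥0∞) =
      ∑ x : Fin N → A, (E x).indicator 1 ω := by
    intro ω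
    have : (admissibleSeqs A a s (V ω : Matrix (Fin N) (Fin N) ℂ) ε).card =
        (Finset.univ.filter fun x : Fin N → A => ω ∈ E x).card := by
      symm
      refine Finset.card_bij (fun x _ k => (x k : ℂ)) ?_ ?_ ?_
      · intro x hx
        simp only [admissibleSeqs, Finset.mem_filter, Fintype.mem_piFinset]
        exact ⟨fun k => (x k).2, (Finset.mem_filter.1 hx).2⟩
      · intro x _ y _ hxy
        funext k
        exact Subtype.ext (congrFun hxy k)
      · intro y hy
        simp only [admissibleSeqs, Finset.mem_filter, Fintype.mem_piFinset] at hy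
        exact ⟨fun k => ⟨y k, hy.1 k⟩, Finset.mem_filter.2 ⟨Finset.mem_univ _, hy.2⟩, rfl⟩
    rw [this, Finset.card_filter, Nat.cast_sum]
    refine Finset.sum_congr rfl fun x _ => ?_
    by_cases hx : ω ∈ E x <;> simp [hx]
  simp_rw [hcard]
  rw [lintegral_finsetSum _ fun x _ => measurable_one.indicator (hmeas x)]
  exact Finset.sum_congr rfl fun x _ => lintegral_indicator_one (hmeas x)

theorem lintegral_card_le_expectedCount (hV : Measurable V) (hN : 0 < N) (s : Fin M → ℝ) (ε : ℝ) :
    ∫⁻ ω, ((admissibleSeqs A a s (V ω : Matrix (Fin N) (Fin N) ℂ) ε).card : ℝ≥0∞) ∂P ≤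
      expectedCount P a V (stdSimplex ℝ A ×ˢ Set.Icc (fun m => s m - ε) s) := by
  rw [lintegral_card_admissibleSeqs hV]
  exact Finset.sum_le_sum fun x _ => measure_mono fun ω hω =>
    ⟨empirical_mem_stdSimplex hN x, fun m => (hω m).1, fun m => (hω m).2⟩

end expectedCount

/-! ### Exponential bounds on the expected count. -/

/-- Mix `p` with the uniform distribution, giving `p` the weight `t = exp (-(η / 2))`. Then `q ≥ t *
p` raises the cross entropy by at most `η / 2`, and full support keeps all logarithms of `q` finite.
-/
theorem exists_crossEntropy_lt {A : Finset ℂ} {p : A → ℝ} (hp : p ∈ stdSimplex ℝ A) {η : ℝ}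
    (hη : 0 < η) :
    ∃ q : A → ℝ, (∀ α, 0 < q α) ∧ ∑ α, q α = 1 ∧
      ∑ α, p α * -Real.log (q α) < shannonEntropy p + η := by
  obtain ⟨hp0, hp1⟩ := hp
  have hne : Nonempty A := by
    by_contra h
    rw [not_nonempty_iff] at h
    simp at hp1
  have hcard : (0 : ℝ) < Fintype.card A := by exact_mod_cast Fintype.card_pos
  set t := Real.exp (-(η / 2)) with ht
  have ht0 : 0 < t := Real.exp_pos _
  have ht1 : t < 1 := (Real.exp_lt_exp.2 (by linarith)).trans_eq Real.exp_zero
  have hq : ∀ α, 0 < t * p α + (1 - t) / Fintype.card A := fun α =>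
    add_pos_of_nonneg_of_pos (mul_nonneg ht0.le (hp0 α)) (div_pos (by linarith) hcard)
  refine ⟨fun α => t * p α + (1 - t) / Fintype.card A, hq, ?_, ?_⟩
  · rw [Finset.sum_add_distrib, ← Finset.mul_sum, hp1, Finset.sum_const, Finset.card_univ,
      nsmul_eq_mul]
    field_simp
    ring
  · have h1 : ∀ α, p α * -Real.log (t * p α + (1 - t) / Fintype.card A) ≤
        Real.negMulLog (p α) + p α * (η / 2) := by
      intro α
      rcases (hp0 α).eq_or_lt with h0 | h0
      · simp [← h0]
      · have hlog : Real.log (t * p α) ≤ Real.log (t * p α + (1 - t) / Fintype.card A) :=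
          Real.log_le_log (by positivity) (le_add_of_nonneg_right (div_nonneg (by linarith) hcard.le))
        rw [Real.log_mul ht0.ne' h0.ne', ht, Real.log_exp] at hlog
        rw [Real.negMulLog]
        nlinarith
    calc _ ≤ ∑ α, (Real.negMulLog (p α) + p α * (η / 2)) := Finset.sum_le_sum fun α _ => h1 α
      _ = shannonEntropy p + η / 2 := by
        rw [Finset.sum_add_distrib, ← Finset.sum_mul, hp1, one_mul, shannonEntropy]
      _ < _ := by linarith

section asymptotics

variable {Ω : Type*} [MeasurableSpace Ω] {P : Measure Ω} [IsProbabilityMeasure P]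
  {V : ∀ N : ℕ, Ω → Matrix.unitaryGroup (Fin N) ℂ} {A : Finset ℂ} {M : ℕ}
  {a : ∀ N : ℕ, Fin N → Fin M} {δ : Fin M → ℝ}

-- Cross entropy against a fixed `q` of full support is linear in the distribution, so bounding it
-- by `h` is an open condition and still limits the count to `exp (N * h)`. Open bounds on band and
-- total energies make one `bandWeight` serve for all sequences in the neighbourhood.
open Classical in
theorem exists_nhds_expectedCount_le (hV : ∀ N, IsHaarDistributed P (V N)) (hδ : ∀ m, 0 < δ m)
    (ha : ∀ m, Tendsto (fun N => bandFraction (a N) m) atTop (𝓝 (δ m)))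
    {p : A → ℝ} (hp : p ∈ stdSimplex ℝ A) {φ : Fin M → ℝ} (hφ : ∀ m, 0 < φ m)
    (hS : 0 < ∑ m, φ m) {β : ℝ} (hβ : pairRate δ p φ < β) :
    ∃ U ∈ 𝓝 (p, φ), ∀ᶠ N : ℕ in atTop,
      expectedCount P (a N) (V N) U ≤ ENNReal.ofReal (Real.exp (N * β)) := by
  have hcont : ContinuousAt (fun η : ℝ => shannonEntropy p + η + ∑ m, (Real.negMulLog (δ m) +
      δ m * Real.log ((φ m + η) / (∑ j, φ j - η)))) 0 := by
    refine (continuousAt_const.add continuousAt_id).add (tendsto_finsetSum _ fun m _ => ?_)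
    refine continuousAt_const.add (continuousAt_const.mul ?_)
    refine ContinuousAt.log (ContinuousAt.div (by fun_prop) (by fun_prop) (by simpa using hS.ne')) ?_
    have := hφ m
    simp only [add_zero, sub_zero]
    positivity
  have h1 := hcont.eventually_lt_const (show _ < β by simpa [pairRate] using hβ)
  obtain ⟨η, ⟨⟨hη, hηS⟩, hη0⟩⟩ := (((h1.filter_mono nhdsWithin_le_nhds).and
    ((gt_mem_nhds hS).filter_mono (nhdsWithin_le_nhds (s := Set.Ioi (0 : ℝ))))).and
      self_mem_nhdsWithin).exists
  have hη0 : 0 < η := hη0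
  obtain ⟨q, hq0, hq1, hq⟩ := exists_crossEntropy_lt hp hη0
  set h := shannonEntropy p + η with hh
  set e := ∑ j, φ j - η with he
  have he0 : 0 < e := by linarith
  have hc : ∀ m, 0 < (φ m + η) / e := fun m => div_pos (by linarith [hφ m]) he0
  refine ⟨{z | ∑ α, z.1 α * -Real.log (q α) < h ∧ (∀ m, z.2 m < φ m + η) ∧ e < ∑ m, z.2 m},
    IsOpen.mem_nhds ?_ ⟨hq, fun m => by simpa using hη0, by simp [he, hη0]⟩, ?_⟩
  · refine IsOpen.and (isOpen_lt (by fun_prop) continuous_const) (IsOpen.and ?_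
      (isOpen_lt continuous_const (by fun_prop)))
    simp only [Set.ofPred_forall]
    exact isOpen_iInter_of_finite fun m => isOpen_lt (by fun_prop) continuous_const
  have hlim := (tendsto_log_bandWeight hδ ha hc).const_add h
  filter_upwards [hlim.eventually_lt_const hη, eventually_gt_atTop 0,
    eventually_forall_bandSize_pos hδ ha] with N hlog hN hn
  have hN' : (0 : ℝ) < N := by positivity
  set T := Finset.univ.filter fun x : Fin N → A => ∑ α, empirical x α * -Real.log (q α) ≤ h
  have hterm : ∀ x : Fin N → A, P {ω | (empirical x, bandEnergy (a N)
      ((V N ω : Matrix (Fin N) (Fin N) ℂ).mulVec fun k => (x k : ℂ))) ∈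
      {z : (A → ℝ) × (Fin M → ℝ) |
        ∑ α, z.1 α * -Real.log (q α) < h ∧ (∀ m, z.2 m < φ m + η) ∧ e < ∑ m, z.2 m}} ≤
      if x ∈ T then ENNReal.ofReal (bandWeight (a N) fun m => (φ m + η) / e) else 0 := by
    intro x
    -- The empirical distribution and the total energy do not depend on `ω`, so a single `ω` in the
    -- event yields the facts about `x` used below.
    rcases Set.eq_empty_or_nonempty {ω | (empirical x, bandEnergy (a N)
      ((V N ω : Matrix (Fin N) (Fin N) ℂ).mulVec fun k => (x k : ℂ))) ∈
      {z : (A → ℝ) × (Fin M → ℝ) |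
        ∑ α, z.1 α * -Real.log (q α) < h ∧ (∀ m, z.2 m < φ m + η) ∧ e < ∑ m, z.2 m}} with h0 | h0
    · rw [h0]; simp
    obtain ⟨ω, hω1, hω2, hω3⟩ := h0
    simp only [sum_bandEnergy_mulVec, meanEnergy_empirical] at hω3
    have hxT : x ∈ T := Finset.mem_filter.2 ⟨Finset.mem_univ _, hω1.le⟩
    rw [if_pos hxT]
    have hx : (fun k => (x k : ℂ)) ≠ 0 := by
      intro h0
      rw [h0] at hω3
      simp [totalEnergy] at hω3
      linarith
    have hle := (hV N).measure_forall_bandSum_le (a N) hn (R := fun m => (φ m + η) * N)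
      (fun m => mul_nonneg (by linarith [hφ m]) hN'.le) hx
    refine (measure_mono ?_).trans (hle.trans (ENNReal.ofReal_le_ofReal ?_))
    · intro ω' hω' m
      have := hω'.2.1 m
      simp only [bandEnergy_eq] at this
      rw [div_lt_iff₀ hN'] at this
      exact this.le
    · unfold bandWeight
      have hT := totalEnergy_pos hx
      refine mul_le_mul_of_nonneg_left (Finset.prod_le_prod (fun m _ => ?_) fun m _ => ?_)
        (by positivity)
      · have := hφ m
        positivity
      · have hm := hφ m
        rw [lt_div_iff₀ hN'] at hω3
        have : (φ m + η) * N / totalEnergy (fun k => (x k : ℂ)) ≤ (φ m + η) / e := by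
          rw [div_le_div_iff₀ hT he0, mul_assoc, mul_comm (N : ℝ)]
          exact mul_le_mul_of_nonneg_left hω3.le (by linarith)
        gcongr
  calc expectedCount P (a N) (V N) _ ≤ ∑ x : Fin N → A,
        if x ∈ T then ENNReal.ofReal (bandWeight (a N) fun m => (φ m + η) / e) else 0 :=
        Finset.sum_le_sum fun x _ => hterm x
    _ = T.card * ENNReal.ofReal (bandWeight (a N) fun m => (φ m + η) / e) := by
        rw [Finset.sum_ite_mem]; simp
    _ ≤ ENNReal.ofReal (Real.exp (N * β)) := by
        rw [← ENNReal.ofReal_natCast, ← ENNReal.ofReal_mul (by positivity)]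
        refine ENNReal.ofReal_le_ofReal ?_
        have hb := bandWeight_pos (a N) hc
        have h2 : bandWeight (a N) (fun m => (φ m + η) / e) ≤ Real.exp (N * (β - h)) := by
          rw [← Real.log_le_iff_le_exp hb, ← div_le_iff₀' hN']
          linarith
        calc (T.card : ℝ) * bandWeight (a N) (fun m => (φ m + η) / e)
            ≤ Real.exp (N * h) * Real.exp (N * (β - h)) :=
              mul_le_mul (card_crossEntropy_le hq0 hq1 hN h) h2 hb.le (Real.exp_pos _).le
          _ = Real.exp (N * β) := by rw [← Real.exp_add]; ring_nf

/-- Induction over the compact product of simplex and box. A point satisfying the energy balance has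
a neighbourhood of rate at most `β`; any other has a neighbourhood that contributes nothing. The
constant `C` accumulates over the finite cover. -/
theorem exists_expectedCount_le (hV : ∀ N, IsHaarDistributed P (V N)) (hδ : ∀ m, 0 < δ m)
    (ha : ∀ m, Tendsto (fun N => bandFraction (a N) m) atTop (𝓝 (δ m))) (hM : 0 < M)
    {s : Fin M → ℝ} {ε : ℝ} (hε : ∀ m, ε < s m) {β : ℝ}
    (hβ : ∀ z ∈ feasiblePairs A s ε, pairRate δ z.1 z.2 < β) :
    ∃ C : ℝ, 0 ≤ C ∧ ∀ᶠ N : ℕ in atTop,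
      expectedCount P (a N) (V N) (stdSimplex ℝ A ×ˢ Set.Icc (fun m => s m - ε) s) ≤
        ENNReal.ofReal (C * Real.exp (N * β)) := by
  have hK : IsCompact (stdSimplex ℝ A ×ˢ Set.Icc (fun m => s m - ε) s) :=
    (isCompact_stdSimplex ℝ A).prod isCompact_Icc
  refine hK.induction_on (p := fun S => ∃ C : ℝ, 0 ≤ C ∧ ∀ᶠ N : ℕ in atTop,
      expectedCount P (a N) (V N) S ≤ ENNReal.ofReal (C * Real.exp (N * β))) ?_ ?_ ?_ ?_
  · exact ⟨0, le_rfl, Eventually.of_forall fun N => by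
      rw [expectedCount_eq_zero (by simp)]; simp⟩
  · rintro S T hST ⟨C, hC, h⟩
    exact ⟨C, hC, h.mono fun N hN => (expectedCount_mono hST).trans hN⟩
  · rintro S T ⟨C, hC, h⟩ ⟨D, hD, h'⟩
    refine ⟨C + D, by positivity, ?_⟩
    filter_upwards [h, h'] with N hN hN'
    refine (expectedCount_union_le S T).trans ((add_le_add hN hN').trans_eq ?_)
    rw [← ENNReal.ofReal_add (by positivity) (by positivity), add_mul]
  · rintro ⟨p, φ⟩ ⟨hp, hφ⟩
    have hφ0 : ∀ m, 0 < φ m := fun m => lt_of_lt_of_le (by linarith [hε m]) (hφ.1 m)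
    by_cases heq : meanEnergy p = ∑ m, φ m
    · obtain ⟨U, hU, hUN⟩ := exists_nhds_expectedCount_le hV hδ ha hp hφ0
        (Finset.sum_pos (fun m _ => hφ0 m) ⟨⟨0, hM⟩, Finset.mem_univ _⟩)
        (hβ (p, φ) ⟨hp, fun m => ⟨hφ.1 m, hφ.2 m⟩, heq⟩)
      exact ⟨U, mem_nhdsWithin_of_mem_nhds hU, 1, zero_le_one, by simpa using hUN⟩
    · refine ⟨{z | meanEnergy z.1 ≠ ∑ m, z.2 m}, mem_nhdsWithin_of_mem_nhds
        (IsOpen.mem_nhds (isOpen_ne_fun (by unfold meanEnergy; fun_prop) (by fun_prop)) heq),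
        0, le_rfl, Eventually.of_forall fun N => ?_⟩
      rw [expectedCount_eq_zero (S := {z | meanEnergy z.1 ≠ ∑ m, z.2 m}) fun z hz => hz]
      simp

-- Keeps only sequences typical for `p`, each with the probability that its relative band energies
-- are close to those of `φ`. As `φ` is interior to the box, small deviations stay admissible.
open Classical in
theorem eventually_le_sum_measure (hV : ∀ N, IsHaarDistributed P (V N)) (hδ : ∀ m, 0 < δ m)
    (ha : ∀ m, Tendsto (fun N => bandFraction (a N) m) atTop (𝓝 (δ m))) (hM : 0 < M)
    {s : Fin M → ℝ} {ε : ℝ} {p : A → ℝ} (hp : ∀ α, 0 < p α) (hp1 : ∑ α, p α = 1)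
    {φ : Fin M → ℝ} (hφ0 : ∀ m, 0 < φ m) (hφ : ∀ m, φ m ∈ Set.Ioo (s m - ε) (s m))
    (heq : meanEnergy p = ∑ m, φ m) {β : ℝ} (hβ : β < pairRate δ p φ) :
    ∀ᶠ N : ℕ in atTop, ENNReal.ofReal (Real.exp (N * β)) ≤
      ∑ x : Fin N → A, P {ω | ∀ m, bandEnergy (a N) ((V N ω : Matrix (Fin N) (Fin N) ℂ).mulVec
        fun k => (x k : ℂ)) m ∈ Set.Icc (s m - ε) (s m)} := by
  have hS : 0 < ∑ m, φ m := Finset.sum_pos (fun m _ => hφ0 m) ⟨⟨0, hM⟩, Finset.mem_univ _⟩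
  set S := ∑ m, φ m with hSdef
  set B := ∑ m, (Real.negMulLog (δ m) + δ m * Real.log (φ m / S)) with hB
  have hβ' : β < shannonEntropy p + B := hβ
  -- A typical sequence has energy per sample within `η` of `S`, and the shell window costs a factor
  -- `1 - η` or its inverse; `e1` and `e2` keep the combination inside the box.
  have e1 : ∀ᶠ η in 𝓝 (0 : ℝ), ∀ m, s m - ε < (1 - η) * (φ m / S) * (S - η) := by
    rw [eventually_all]
    intro m
    have : ContinuousAt (fun η : ℝ => (1 - η) * (φ m / S) * (S - η)) 0 := by fun_prop
    refine this.eventually_const_lt ?_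
    simp only [sub_zero, one_mul, div_mul_cancel₀ _ hS.ne']
    exact (hφ m).1
  have e2 : ∀ᶠ η in 𝓝 (0 : ℝ), ∀ m, (1 - η)⁻¹ * (φ m / S) * (S + η) < s m := by
    rw [eventually_all]
    intro m
    have : ContinuousAt (fun η : ℝ => (1 - η)⁻¹ * (φ m / S) * (S + η)) 0 :=
      ContinuousAt.mul (ContinuousAt.mul (ContinuousAt.inv₀ (by fun_prop) (by simp))
        (by fun_prop)) (by fun_prop)
    refine this.eventually_lt_const ?_
    simp only [sub_zero, inv_one, one_mul, add_zero, div_mul_cancel₀ _ hS.ne']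
    exact (hφ m).2
  -- One `η` each for the typical count, the convergence of `bandWeight`, and the prefactor `1 / 2 *
  -- η ^ M`.
  have e3 : ∀ᶠ η in 𝓝 (0 : ℝ), 3 * η < shannonEntropy p + B - β := by
    have : ContinuousAt (fun η : ℝ => 3 * η) 0 := by fun_prop
    refine this.eventually_lt_const ?_
    linarith
  obtain ⟨η, ⟨⟨⟨⟨⟨h1, h2⟩, h3⟩, h4⟩, h5⟩, hη0⟩⟩ := ((((((e1.and e2).and e3).and
    (gt_mem_nhds hS)).and (gt_mem_nhds one_pos)).filter_mono nhdsWithin_le_nhds).and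
      (self_mem_nhdsWithin (s := Set.Ioi (0 : ℝ)))).exists
  have hη0 : 0 < η := hη0
  have hc : ∀ m, 0 < φ m / S := fun m => div_pos (hφ0 m) hS
  have hconst : ∀ᶠ N : ℕ in atTop, -Real.log (1 / 2 * η ^ M) ≤ N * η :=
    (tendsto_natCast_atTop_atTop.atTop_mul_const hη0).eventually_ge_atTop _
  filter_upwards [eventually_le_card_typical hp hp1 (fun α => ‖(α : ℂ)‖ ^ 2) hη0,
    (tendsto_log_bandWeight hδ ha hc).eventually_const_lt (show B - η < B by linarith), hconst,
    eventually_gt_atTop 0, eventually_forall_bandSize_pos hδ ha] with N hcard hbw hNη hN hn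
  have hN' : (0 : ℝ) < N := by positivity
  set T := Finset.univ.filter fun x : Fin N → A => |∑ α, empirical x α * ‖(α : ℂ)‖ ^ 2 -
    ∑ α, p α * ‖(α : ℂ)‖ ^ 2| < η with hT
  have hterm : ∀ x ∈ T, ENNReal.ofReal (η ^ M * bandWeight (a N) fun m => φ m / S) ≤
      P {ω | ∀ m, bandEnergy (a N) ((V N ω : Matrix (Fin N) (Fin N) ℂ).mulVec
        fun k => (x k : ℂ)) m ∈ Set.Icc (s m - ε) (s m)} := by
    intro x hx
    have hx' : |meanEnergy (empirical x) - S| < η := by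
      rw [← heq]
      exact (Finset.mem_filter.1 hx).2
    rw [meanEnergy_empirical, abs_lt] at hx'
    set t := totalEnergy (fun k => (x k : ℂ)) with ht
    have ht0 : 0 < t / N := by linarith
    have hx0 : (fun k => (x k : ℂ)) ≠ 0 := by
      intro h0
      rw [ht, h0] at ht0
      simp [totalEnergy] at ht0
    refine ((hV N).le_measure_forall_bandSum_mem (a N) hn hφ0 hx0 hη0.le h5).trans
      (measure_mono fun ω hω m => ?_)
    have hm := hω m
    simp only [← ht, ← hSdef] at hm
    have hcm := hc m
    have h1η : 0 < 1 - η := by linarith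
    rw [bandEnergy_eq]
    constructor
    · rw [le_div_iff₀ hN']
      refine le_trans ?_ hm.1
      calc (s m - ε) * N ≤ (1 - η) * (φ m / S) * (S - η) * N :=
            mul_le_mul_of_nonneg_right (h1 m).le hN'.le
        _ ≤ (1 - η) * (φ m / S) * (t / N) * N := by gcongr; linarith
        _ = _ := by field_simp
    · rw [div_le_iff₀ hN']
      refine hm.2.trans ?_
      calc (1 - η)⁻¹ * (φ m / S) * t = (1 - η)⁻¹ * (φ m / S) * (t / N) * N := by field_simp
        _ ≤ (1 - η)⁻¹ * (φ m / S) * (S + η) * N := by gcongr; linarith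
        _ ≤ _ := mul_le_mul_of_nonneg_right (h2 m).le hN'.le
  have hb := bandWeight_pos (a N) hc
  have hbexp : Real.exp (N * (B - η)) ≤ bandWeight (a N) fun m => φ m / S := by
    rw [← Real.le_log_iff_exp_le hb, ← le_div_iff₀' hN']
    exact hbw.le
  have hcexp : Real.exp (-(N * η)) ≤ 1 / 2 * η ^ M := by
    rw [← Real.le_log_iff_exp_le (by positivity)]
    linarith
  calc ENNReal.ofReal (Real.exp (N * β))
      ≤ ENNReal.ofReal (T.card * (η ^ M * bandWeight (a N) fun m => φ m / S)) := by
        refine ENNReal.ofReal_le_ofReal ?_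
        calc Real.exp (N * β) ≤ Real.exp (-(N * η)) * Real.exp (N * (shannonEntropy p - η)) *
              Real.exp (N * (B - η)) := by
              rw [← Real.exp_add, ← Real.exp_add, Real.exp_le_exp]
              nlinarith
          _ ≤ (1 / 2 * η ^ M) * Real.exp (N * (shannonEntropy p - η)) *
              bandWeight (a N) (fun m => φ m / S) := by gcongr
          _ = (1 / 2 * Real.exp (N * (shannonEntropy p - η))) *
              (η ^ M * bandWeight (a N) fun m => φ m / S) := by ring
          _ ≤ _ := mul_le_mul_of_nonneg_right hcard (by positivity)
    _ = ∑ x ∈ T, ENNReal.ofReal (η ^ M * bandWeight (a N) fun m => φ m / S) := by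
        rw [ENNReal.ofReal_mul (by positivity), ENNReal.ofReal_natCast, Finset.sum_const,
          nsmul_eq_mul]
    _ ≤ _ := (Finset.sum_le_sum hterm).trans
        (Finset.sum_le_sum_of_subset (Finset.subset_univ T))

end asymptotics

/-! ### From bounds on the expectation to bounds on the rate. -/

section rate

variable {Ω : Type*} [MeasurableSpace Ω] {P : Measure Ω} {M : ℕ} {A : Finset ℂ} {s : Fin M → ℝ}
  {ε : ℝ}

theorem log_ofReal_exp (t : ℝ) : ENNReal.log (ENNReal.ofReal (Real.exp t)) = (t : EReal) := by
  rw [ENNReal.log_ofReal_of_pos (Real.exp_pos t), Real.log_exp]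

theorem le_annealedRate {N : ℕ} (hN : 0 < N) {a : Fin N → Fin M}
    {V : Ω → Matrix.unitaryGroup (Fin N) ℂ} {β : ℝ}
    (h : ENNReal.ofReal (Real.exp (N * β)) ≤
      ∫⁻ ω, ((admissibleSeqs A a s (V ω : Matrix (Fin N) (Fin N) ℂ) ε).card : ℝ≥0∞) ∂P) :
    (β : EReal) ≤ annealedRate P A a s V ε := by
  have hN' : (0 : ℝ) < N := by positivity
  rw [annealedRate, EReal.le_div_iff_mul_le (by exact_mod_cast hN') (EReal.coe_ne_top _),
    ← EReal.coe_mul, mul_comm, ← log_ofReal_exp]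
  exact ENNReal.log_monotone h

theorem annealedRate_le {N : ℕ} (hN : 0 < N) {a : Fin N → Fin M}
    {V : Ω → Matrix.unitaryGroup (Fin N) ℂ} {β : ℝ}
    (h : ∫⁻ ω, ((admissibleSeqs A a s (V ω : Matrix (Fin N) (Fin N) ℂ) ε).card : ℝ≥0∞) ∂P ≤
      ENNReal.ofReal (Real.exp (N * β))) :
    annealedRate P A a s V ε ≤ β := by
  have hN' : (0 : ℝ) < N := by positivity
  rw [annealedRate, EReal.div_le_iff_le_mul (by exact_mod_cast hN') (EReal.coe_ne_top _),
    ← EReal.coe_mul, ← log_ofReal_exp]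
  exact ENNReal.log_monotone h

/-- The gap between `β` and `β'` eventually absorbs the constant `C`. -/
theorem eventually_annealedRate_le {a : ∀ N : ℕ, Fin N → Fin M}
    {V : ∀ N : ℕ, Ω → Matrix.unitaryGroup (Fin N) ℂ} {C β β' : ℝ} (hβ : β < β')
    (h : ∀ᶠ N : ℕ in atTop,
      ∫⁻ ω, ((admissibleSeqs A (a N) s (V N ω : Matrix (Fin N) (Fin N) ℂ) ε).card : ℝ≥0∞) ∂P ≤
        ENNReal.ofReal (C * Real.exp (N * β))) :
    ∀ᶠ N : ℕ in atTop, annealedRate P A (a N) s (V N) ε ≤ β' := by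
  have hC' : ∀ᶠ N : ℕ in atTop, C ≤ Real.exp (N * (β' - β)) :=
    (Real.tendsto_exp_atTop.comp
      (tendsto_natCast_atTop_atTop.atTop_mul_const (sub_pos.2 hβ))).eventually_ge_atTop C
  filter_upwards [h, hC', eventually_gt_atTop 0] with N hN hCN hN0
  refine annealedRate_le hN0 (hN.trans (ENNReal.ofReal_le_ofReal ?_))
  calc C * Real.exp (N * β) ≤ Real.exp (N * (β' - β)) * Real.exp (N * β) := by gcongr
    _ = _ := by rw [← Real.exp_add]; ring_nf

end rate

/-! ### The variational problem and its limit for small tolerance. -/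

section feasiblePairs

variable {A : Finset ℂ} {M : ℕ} {δ : Fin M → ℝ} {s : Fin M → ℝ}

theorem continuousAt_pairRate (hM : 0 < M) {z : (A → ℝ) × (Fin M → ℝ)} (hz : ∀ m, 0 < z.2 m) :
    ContinuousAt (fun z : (A → ℝ) × (Fin M → ℝ) => pairRate δ z.1 z.2) z := by
  have hS : 0 < ∑ m, z.2 m := Finset.sum_pos (fun m _ => hz m) ⟨⟨0, hM⟩, Finset.mem_univ _⟩
  have h1 : Continuous fun z : (A → ℝ) × (Fin M → ℝ) => shannonEntropy z.1 :=
    continuous_finsetSum _ fun α _ => Real.continuous_negMulLog.comp (by fun_prop)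
  refine h1.continuousAt.add (tendsto_finsetSum _ fun m _ => ?_)
  refine continuousAt_const.add (continuousAt_const.mul ?_)
  exact ContinuousAt.log (ContinuousAt.div (by fun_prop) (by fun_prop) hS.ne')
    (div_pos (hz m) hS).ne'

theorem isCompact_feasiblePairs (A : Finset ℂ) (s : Fin M → ℝ) (ε : ℝ) :
    IsCompact (feasiblePairs A s ε) := by
  have hK : IsCompact (stdSimplex ℝ A ×ˢ Set.Icc (fun m => s m - ε) s) :=
    (isCompact_stdSimplex ℝ A).prod isCompact_Icc
  have : feasiblePairs A s ε = (stdSimplex ℝ A ×ˢ Set.Icc (fun m => s m - ε) s) ∩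
      {z | meanEnergy z.1 = ∑ m, z.2 m} := by
    ext z
    simp only [feasiblePairs, Set.mem_ofPred_eq, Set.mem_inter_iff, Set.mem_prod, Set.mem_Icc,
      Pi.le_def, forall_and, and_assoc]
  rw [this]
  exact hK.inter_right (isClosed_eq (by unfold meanEnergy; fun_prop) (by fun_prop))

/-- A compact set of feasible pairs that contains no pair with band energies `s` is disjoint from
the feasible pairs of small tolerance. -/
theorem eventually_forall_notMem_feasiblePairs {ε₀ : ℝ} {T : Set ((A → ℝ) × (Fin M → ℝ))}
    (hT : IsCompact T) (hsub : T ⊆ feasiblePairs A s ε₀) (hs : ∀ z ∈ T, z.2 ≠ s) :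
    ∀ᶠ ε in 𝓝[>] (0 : ℝ), ∀ z ∈ T, z ∉ feasiblePairs A s ε := by
  rcases T.eq_empty_or_nonempty with rfl | hne
  · simp
  -- The total deficit `∑ m, (s m - z.2 m)` attains a positive minimum on `T`, while tolerance `ε`
  -- allows a deficit of at most `M * ε`.
  obtain ⟨z₀, hz₀, hmin⟩ := hT.exists_isMinOn (f := fun z => ∑ m, (s m - z.2 m)) hne
    (by fun_prop)
  have hnn : ∀ m, 0 ≤ s m - z₀.2 m := fun m => sub_nonneg.2 ((hsub hz₀).2.1 m).2
  have hc : 0 < ∑ m, (s m - z₀.2 m) := by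
    obtain ⟨m, hm⟩ := Function.ne_iff.1 (hs z₀ hz₀)
    exact Finset.sum_pos' (fun m _ => hnn m)
      ⟨m, Finset.mem_univ _, lt_of_le_of_ne (hnn m) fun h => hm (sub_eq_zero.1 h.symm).symm⟩
  have hcont : ContinuousAt (fun ε : ℝ => M * ε) 0 := by fun_prop
  filter_upwards [(hcont.eventually_lt_const (show (M : ℝ) * 0 < ∑ m, (s m - z₀.2 m) by rwa [mul_zero])).filter_mono nhdsWithin_le_nhds]
    with ε hε z hz hzε
  have h1 : ∑ m, (s m - z₀.2 m) ≤ ∑ m, (s m - z.2 m) := hmin hz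
  have h2 : ∑ m, (s m - z.2 m) ≤ ∑ _m : Fin M, ε :=
    Finset.sum_le_sum fun m _ => by linarith [(hzε.2.1 m).1]
  simp only [Finset.sum_const, Finset.card_univ, Fintype.card_fin, nsmul_eq_mul] at h2
  linarith

theorem feasiblePairs_mono {ε ε' : ℝ} (h : ε ≤ ε') :
    feasiblePairs A s ε ⊆ feasiblePairs A s ε' :=
  fun _ hz => ⟨hz.1, fun m => ⟨by linarith [(hz.2.1 m).1], (hz.2.1 m).2⟩, hz.2.2⟩

theorem eventually_feasiblePairs_eq_empty
    (h : ¬ (distributionsWithSecondMoment A (∑ m, s m)).Nonempty) :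
    ∀ᶠ ε in 𝓝[>] (0 : ℝ), feasiblePairs A s ε = ∅ := by
  have h1 := eventually_forall_notMem_feasiblePairs (isCompact_feasiblePairs A s 1) subset_rfl
    fun z hz hzs => h ⟨z.1, hz.1, hz.2.2.trans (by rw [hzs])⟩
  filter_upwards [h1, (gt_mem_nhds one_pos).filter_mono nhdsWithin_le_nhds] with ε hε hε1
  exact Set.eq_empty_iff_forall_notMem.2 fun z hz => hε z (feasiblePairs_mono hε1.le hz) hz

theorem eventually_forall_tolerance_lt (hs : ∀ m, 0 < s m) : ∀ᶠ ε in 𝓝[>] (0 : ℝ), ∀ m, ε < s m :=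
  eventually_all.2 fun m => (gt_mem_nhds (hs m)).filter_mono nhdsWithin_le_nhds

/-- For a fixed `ε₀` below every `s m`, where `pairRate` is continuous, the feasible pairs of rate
at least `β` form a compact set. It contains no pair with band energies `s`, so small tolerances
miss it. -/
theorem eventually_forall_pairRate_lt (hM : 0 < M) (hs : ∀ m, 0 < s m) {β : ℝ}
    (hβ : ∀ p ∈ distributionsWithSecondMoment A (∑ m, s m), pairRate δ p s < β) :
    ∀ᶠ ε in 𝓝[>] (0 : ℝ), ∀ z ∈ feasiblePairs A s ε, pairRate δ z.1 z.2 < β := by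
  obtain ⟨ε₀, hε₀, hpos⟩ := ((eventually_forall_tolerance_lt hs).and
    (self_mem_nhdsWithin (s := Set.Ioi (0 : ℝ)))).exists
  have hcont : ContinuousOn (fun z : (A → ℝ) × (Fin M → ℝ) => pairRate δ z.1 z.2)
      (feasiblePairs A s ε₀) := fun z hz => (continuousAt_pairRate hM fun m =>
        lt_of_lt_of_le (sub_pos.2 (hε₀ m)) (hz.2.1 m).1).continuousWithinAt
  have hcomp : IsCompact (feasiblePairs A s ε₀ ∩
      (fun z : (A → ℝ) × (Fin M → ℝ) => pairRate δ z.1 z.2) ⁻¹' Set.Ici β) :=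
    (isCompact_feasiblePairs A s ε₀).of_isClosed_subset
      (hcont.preimage_isClosed_of_isClosed (isCompact_feasiblePairs A s ε₀).isClosed isClosed_Ici)
      Set.inter_subset_left
  have h1 := eventually_forall_notMem_feasiblePairs hcomp Set.inter_subset_left
    fun z hz hzs => by
      have h2 := hβ z.1 ⟨hz.1.1, hz.1.2.2.trans (by rw [hzs])⟩
      have h3 : β ≤ pairRate δ z.1 z.2 := hz.2
      rw [hzs] at h3
      linarith
  filter_upwards [h1, (gt_mem_nhds hpos).filter_mono nhdsWithin_le_nhds] with ε hε hε1 z hz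
  by_contra hcon
  exact hε z ⟨feasiblePairs_mono (le_of_lt hε1) hz, not_lt.1 hcon⟩ hz

/-- If some point of `A` has energy below `∑ m, s m`, there is a feasible pair of full support with
band energies in the interior of the box. -/
theorem exists_interior_pair (hM : 0 < M) {p : A → ℝ}
    (hp : p ∈ distributionsWithSecondMoment A (∑ m, s m)) {α₀ : A}
    (hα₀ : ‖(α₀ : ℂ)‖ ^ 2 < ∑ m, s m) {ε : ℝ} (hε : 0 < ε) :
    ∃ (q : A → ℝ) (ψ : Fin M → ℝ), (∀ α, 0 < q α) ∧ ∑ α, q α = 1 ∧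
      (∀ m, ψ m ∈ Set.Ioo (s m - ε) (s m)) ∧ meanEnergy q = ∑ m, ψ m := by
  classical
  set S := ∑ m, s m with hS
  have hcard : (0 : ℝ) < Fintype.card A := by exact_mod_cast Fintype.card_pos_iff.2 ⟨α₀⟩
  have hM' : (0 : ℝ) < M := by positivity
  let U : ℝ := (∑ α : A, ‖(α : ℂ)‖ ^ 2) / Fintype.card A
  have hc1 : ContinuousAt (fun κ : ℝ => (1 - κ) * ‖(α₀ : ℂ)‖ ^ 2 + κ * U) 0 := by fun_prop
  obtain ⟨κ, ⟨hκ1, hκ2⟩, hκ0⟩ := ((((hc1.eventually_lt_const (show _ < S by simpa using hα₀)).and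
    (gt_mem_nhds one_pos)).filter_mono nhdsWithin_le_nhds).and
      (self_mem_nhdsWithin (s := Set.Ioi (0 : ℝ)))).exists
  have hκ0 : 0 < κ := hκ0
  -- Mostly concentrated at `α₀`, with a uniform admixture `κ` for full support that is small enough
  -- to keep the mean energy below `S`.
  set r : A → ℝ := fun α => (1 - κ) * (if α = α₀ then 1 else 0) + κ / Fintype.card A with hr
  have hr0 : ∀ α, 0 < r α := fun α => by
    refine add_pos_of_nonneg_of_pos (mul_nonneg (by linarith) (by split_ifs <;> simp)) ?_
    positivity
  have hr1 : ∑ α, r α = 1 := by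
    simp only [hr, Finset.sum_add_distrib, ← Finset.mul_sum, Finset.sum_const, Finset.card_univ,
      nsmul_eq_mul, Finset.sum_ite_eq', Finset.mem_univ, if_true]
    field_simp
    ring
  have hrE : meanEnergy r = (1 - κ) * ‖(α₀ : ℂ)‖ ^ 2 + κ * U := by
    simp only [meanEnergy, hr, add_mul, Finset.sum_add_distrib, mul_assoc, ite_mul, one_mul,
      zero_mul, ← Finset.mul_sum, Finset.sum_ite_eq', Finset.mem_univ, if_true, U]
    ring
  rw [← hrE] at hκ1
  have hc2 : ContinuousAt (fun θ : ℝ => θ * (S - meanEnergy r)) 0 := by fun_prop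
  obtain ⟨θ, ⟨hθ1, hθ2⟩, hθ0⟩ := ((((hc2.eventually_lt_const (show _ < M * ε by
    simpa using by positivity)).and
    (gt_mem_nhds one_pos)).filter_mono nhdsWithin_le_nhds).and
      (self_mem_nhdsWithin (s := Set.Ioi (0 : ℝ)))).exists
  have hθ0 : 0 < θ := hθ0
  have hpE : meanEnergy p = S := hp.2
  -- Moving from `p` towards `r` lowers the energy by `θ * (S - meanEnergy r)`; this loss is shared
  -- equally among the bands and is below `ε` in each.
  refine ⟨fun α => (1 - θ) * p α + θ * r α, fun m => s m - θ * (S - meanEnergy r) / M,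
    fun α => ?_, ?_, fun m => ⟨?_, ?_⟩, ?_⟩
  · exact add_pos_of_nonneg_of_pos (mul_nonneg (by linarith) (hp.1.1 α)) (mul_pos hθ0 (hr0 α))
  · rw [Finset.sum_add_distrib, ← Finset.mul_sum, ← Finset.mul_sum, hr1, hp.1.2]
    ring
  · have : θ * (S - meanEnergy r) / M < ε := by rwa [div_lt_iff₀ hM', mul_comm ε]
    linarith
  · have : 0 < θ * (S - meanEnergy r) / M := div_pos (mul_pos hθ0 (by linarith)) hM'
    linarith
  · have h1 : meanEnergy (fun α => (1 - θ) * p α + θ * r α) =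
        (1 - θ) * meanEnergy p + θ * meanEnergy r := by
      simp only [meanEnergy, add_mul, Finset.sum_add_distrib, mul_assoc, Finset.mul_sum]
    rw [h1, hpE, Finset.sum_sub_distrib, ← hS, Finset.sum_const, Finset.card_univ,
      Fintype.card_fin, nsmul_eq_mul]
    field_simp
    ring

/-- The rate of a feasible pair is approached by pairs of full support with band energies in the
interior of the box, if there is one. -/
theorem exists_interior_pair_pairRate_gt (hM : 0 < M) {ε : ℝ} (hε : ∀ m, ε < s m)
    {z : (A → ℝ) × (Fin M → ℝ)} (hz : z ∈ feasiblePairs A s ε) {q : A → ℝ} {ψ : Fin M → ℝ}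
    (hq0 : ∀ α, 0 < q α) (hq1 : ∑ α, q α = 1) (hψ : ∀ m, ψ m ∈ Set.Ioo (s m - ε) (s m))
    (hE : meanEnergy q = ∑ m, ψ m) {β : ℝ} (hβ : β < pairRate δ z.1 z.2) :
    ∃ (p : A → ℝ) (φ : Fin M → ℝ), (∀ α, 0 < p α) ∧ ∑ α, p α = 1 ∧
      (∀ m, φ m ∈ Set.Ioo (s m - ε) (s m)) ∧ meanEnergy p = ∑ m, φ m ∧ β < pairRate δ p φ := by
  -- The constraints are convex, so the segment from `z` to the interior pair is interior for every
  -- `θ ∈ (0, 1)`; continuity at `θ = 0` retains the rate bound.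
  let c : ℝ → (A → ℝ) × (Fin M → ℝ) := fun θ =>
    (fun α => (1 - θ) * z.1 α + θ * q α, fun m => (1 - θ) * z.2 m + θ * ψ m)
  have hc0 : c 0 = z := by simp [c]
  have hc : ContinuousAt c 0 := by fun_prop
  have hcr : ContinuousAt (fun θ => pairRate δ (c θ).1 (c θ).2) 0 :=
    ContinuousAt.comp (g := fun z : (A → ℝ) × (Fin M → ℝ) => pairRate δ z.1 z.2) (by
      rw [hc0]
      exact continuousAt_pairRate hM fun m => lt_of_lt_of_le (sub_pos.2 (hε m)) (hz.2.1 m).1) hc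
  obtain ⟨θ, ⟨hθ1, hθ2⟩, hθ0⟩ := ((((hcr.eventually_const_lt (show β < _ by
    simpa only [hc0] using hβ)).and
    (gt_mem_nhds one_pos)).filter_mono nhdsWithin_le_nhds).and
      (self_mem_nhdsWithin (s := Set.Ioi (0 : ℝ)))).exists
  have hθ0 : 0 < θ := hθ0
  refine ⟨(c θ).1, (c θ).2, fun α => ?_, ?_, fun m => ⟨?_, ?_⟩, ?_, hθ1⟩
  · exact add_pos_of_nonneg_of_pos (mul_nonneg (by linarith) (hz.1.1 α)) (mul_pos hθ0 (hq0 α))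
  · simp only [c]
    rw [Finset.sum_add_distrib, ← Finset.mul_sum, ← Finset.mul_sum, hq1, hz.1.2]
    ring
  · have h1 := (hz.2.1 m).1
    have h2 := (hψ m).1
    simp only [c]
    nlinarith
  · have h1 := (hz.2.1 m).2
    have h2 := (hψ m).2
    simp only [c]
    nlinarith
  · have h1 : meanEnergy (c θ).1 = (1 - θ) * meanEnergy z.1 + θ * meanEnergy q := by
      simp only [c, meanEnergy, add_mul, Finset.sum_add_distrib, mul_assoc, Finset.mul_sum]
    rw [h1, hz.2.2, hE]
    simp only [c, Finset.sum_add_distrib, Finset.mul_sum]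

theorem pairRate_eq (hδ : ∀ m, 0 < δ m) (hs : ∀ m, 0 < s m) (p : A → ℝ) :
    ((pairRate δ p s : ℝ) : EReal) =
      (shannonEntropy p : EReal) - relativeEntropy δ fun m => s m / ∑ j, s j := by
  have hS : ∀ m : Fin M, 0 < s m / ∑ j, s j := fun m =>
    div_pos (hs m) (Finset.sum_pos (fun j _ => hs j) ⟨m, Finset.mem_univ _⟩)
  rw [relativeEntropy, if_pos fun m h => ((hS m).ne' h).elim, ← EReal.coe_sub, pairRate,
    sub_eq_add_neg, ← Finset.sum_neg_distrib]
  congr 2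
  refine Finset.sum_congr rfl fun m _ => ?_
  rw [Real.log_div (hδ m).ne' (hS m).ne', Real.negMulLog]
  ring

/-- From below, an entropy maximizer paired with `s` is feasible at every positive tolerance; from
above, compactness excludes larger rates. If no distribution has energy `∑ m, s m`, both sides are
`⊥`. -/
theorem tendsto_iSup_pairRate (hM : 0 < M) (hδ : ∀ m, 0 < δ m) (hs : ∀ m, 0 < s m) :
    Tendsto (fun ε => ⨆ z ∈ feasiblePairs A s ε, (pairRate δ z.1 z.2 : EReal)) (𝓝[>] (0 : ℝ))
      (𝓝 (maxEntropy A (∑ m, s m) - relativeEntropy δ (fun m => s m / ∑ j, s j))) := by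
  by_cases h : (distributionsWithSecondMoment A (∑ m, s m)).Nonempty
  · obtain ⟨p, hp, hmax⟩ := exists_shannonEntropy_eq_maxEntropy A _ h
    rw [← hmax, ← pairRate_eq hδ hs]
    refine tendsto_order.2 ⟨fun b hb => ?_, fun b hb => ?_⟩
    · filter_upwards [self_mem_nhdsWithin] with ε hε
      have hε : 0 < ε := hε
      refine hb.trans_le (le_iSup₂ (f := fun (z : (A → ℝ) × (Fin M → ℝ))
        (_ : z ∈ feasiblePairs A s ε) => (pairRate δ z.1 z.2 : EReal)) (p, s) ?_)
      exact ⟨hp.1, fun m => ⟨by linarith, le_rfl⟩, hp.2⟩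
    · obtain ⟨β, hβ1, hβ2⟩ := EReal.lt_iff_exists_real_btwn.1 hb
      filter_upwards [eventually_forall_pairRate_lt (A := A) (δ := δ) hM hs (β := β) fun q hq => by
        refine lt_of_le_of_lt ?_ (EReal.coe_lt_coe_iff.1 hβ1)
        have : (shannonEntropy q : EReal) ≤ shannonEntropy p := by
          rw [hmax]
          exact le_iSup₂ (f := fun p _ => (shannonEntropy p : EReal)) q hq
        have := EReal.coe_le_coe_iff.1 this
        unfold pairRate
        linarith] with ε hε
      exact (iSup₂_le fun z hz => EReal.coe_le_coe_iff.2 (hε z hz).le).trans_lt hβ2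
  · have hbot : maxEntropy A (∑ m, s m) = ⊥ := by
      rw [Set.not_nonempty_iff_eq_empty] at h
      simp [maxEntropy, h]
    rw [hbot, sub_eq_add_neg, EReal.bot_add]
    refine tendsto_const_nhds.congr' ?_
    filter_upwards [eventually_feasiblePairs_eq_empty h] with ε hε
    simp [hε]

end feasiblePairs

/-! ### Limits at fixed tolerance and the degenerate cases. -/

section limits

variable {Ω : Type*} [MeasurableSpace Ω] {P : Measure Ω} [IsProbabilityMeasure P]
  {V : ∀ N : ℕ, Ω → Matrix.unitaryGroup (Fin N) ℂ} {A : Finset ℂ} {M : ℕ}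
  {a : ∀ N : ℕ, Fin N → Fin M} {δ : Fin M → ℝ} {s : Fin M → ℝ}

theorem eventually_annealedRate_lt (hV : ∀ N, IsHaarDistributed P (V N)) (hδ : ∀ m, 0 < δ m)
    (ha : ∀ m, Tendsto (fun N => bandFraction (a N) m) atTop (𝓝 (δ m))) (hM : 0 < M)
    {ε : ℝ} (hε : ∀ m, ε < s m) {b : EReal}
    (hb : ⨆ z ∈ feasiblePairs A s ε, (pairRate δ z.1 z.2 : EReal) < b) :
    ∀ᶠ N : ℕ in atTop, annealedRate P A (a N) s (V N) ε < b := by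
  obtain ⟨β', h1, h2⟩ := EReal.lt_iff_exists_real_btwn.1 hb
  obtain ⟨β, h3, h4⟩ := EReal.lt_iff_exists_real_btwn.1 h1
  obtain ⟨C, hC, hCN⟩ := exists_expectedCount_le (A := A) hV hδ ha hM hε (β := β) fun z hz =>
    EReal.coe_lt_coe_iff.1 ((le_iSup₂ (f := fun (z : (A → ℝ) × (Fin M → ℝ))
        (_ : z ∈ feasiblePairs A s ε) => (pairRate δ z.1 z.2 : EReal)) z hz).trans_lt h3)
  filter_upwards [eventually_annealedRate_le (A := A) (s := s) (ε := ε)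
    (EReal.coe_lt_coe_iff.1 h4) (by
      filter_upwards [hCN, eventually_gt_atTop 0] with N hN hN0
      exact (lintegral_card_le_expectedCount (hV N).measurable hN0 s ε).trans hN)] with N hN
  exact hN.trans_lt h2

theorem eventually_le_annealedRate (hV : ∀ N, IsHaarDistributed P (V N)) (hδ : ∀ m, 0 < δ m)
    (ha : ∀ m, Tendsto (fun N => bandFraction (a N) m) atTop (𝓝 (δ m))) (hM : 0 < M)
    {p : A → ℝ} (hp : p ∈ distributionsWithSecondMoment A (∑ m, s m)) {α₀ : A}
    (hα₀ : ‖(α₀ : ℂ)‖ ^ 2 < ∑ m, s m) {ε : ℝ} (hε0 : 0 < ε) (hε : ∀ m, ε < s m)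
    {z : (A → ℝ) × (Fin M → ℝ)} (hz : z ∈ feasiblePairs A s ε) {β : ℝ}
    (hβ : β < pairRate δ z.1 z.2) :
    ∀ᶠ N : ℕ in atTop, (β : EReal) ≤ annealedRate P A (a N) s (V N) ε := by
  obtain ⟨q, ψ, hq0, hq1, hψ, hE⟩ := exists_interior_pair hM hp hα₀ hε0
  obtain ⟨r, φ, hr0, hr1, hφ, hE', hβ'⟩ :=
    exists_interior_pair_pairRate_gt hM hε hz hq0 hq1 hψ hE hβ
  filter_upwards [eventually_le_sum_measure hV hδ ha hM hr0 hr1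
    (fun m => (sub_pos.2 (hε m)).trans (hφ m).1) hφ hE' hβ', eventually_gt_atTop 0] with N hN hN0
  refine le_annealedRate hN0 ?_
  rwa [lintegral_card_admissibleSeqs (hV N).measurable]

-- The inequality `log t ≤ t - 1` at `t = 1 / (S.card * p α)`, averaged over `p`.
open Classical in
theorem shannonEntropy_le_log_card {p : A → ℝ} (hp : p ∈ stdSimplex ℝ A) {S : Finset A}
    (hS : ∀ α ∉ S, p α = 0) : shannonEntropy p ≤ Real.log S.card := by
  have hsum : ∑ α ∈ S, p α = 1 := by
    rw [← hp.2]
    exact Finset.sum_subset (Finset.subset_univ S) fun α _ h => hS α h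
  have hne : 0 < S.card := by
    rw [Finset.card_pos]
    by_contra h
    simp [Finset.not_nonempty_iff_eq_empty.1 h] at hsum
  have hk : (0 : ℝ) < S.card := by exact_mod_cast hne
  have h1 : shannonEntropy p = ∑ α ∈ S, Real.negMulLog (p α) :=
    (Finset.sum_subset (Finset.subset_univ S) fun α _ h => by simp [hS α h]).symm
  rw [h1]
  have h2 : ∀ α ∈ S, Real.negMulLog (p α) ≤ p α * Real.log S.card + (1 / S.card - p α) := by
    intro α _
    rcases (hp.1 α).eq_or_lt with h0 | h0
    · simp [← h0]
    · have h3 := Real.log_le_sub_one_of_pos (show 0 < 1 / (S.card * p α) by positivity)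
      rw [one_div, Real.log_inv, Real.log_mul hk.ne' h0.ne'] at h3
      have h4 := mul_le_mul_of_nonneg_left h3 h0.le
      rw [Real.negMulLog]
      have h5 : p α * ((S.card * p α)⁻¹ - 1) = 1 / S.card - p α := by field_simp
      linarith
  refine (Finset.sum_le_sum h2).trans ?_
  rw [Finset.sum_add_distrib, ← Finset.sum_mul, Finset.sum_sub_distrib, hsum, Finset.sum_const,
    nsmul_eq_mul]
  field_simp
  linarith

-- With no symbol of energy below `s 0` there is no interior pair. Feasibility forces `z.1` onto the
-- symbols of energy exactly `s 0`, so its entropy is at most the logarithm of their number. Every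
-- sequence of such symbols is admissible surely, because the single band carries the whole energy.
open Classical in
theorem eventually_le_annealedRate_of_least {V : ∀ N : ℕ, Ω → Matrix.unitaryGroup (Fin N) ℂ}
    (hV : ∀ N, IsHaarDistributed P (V N)) {a : ∀ N : ℕ, Fin N → Fin 1} {δ s : Fin 1 → ℝ}
    (ha : ∀ m, Tendsto (fun N => bandFraction (a N) m) atTop (𝓝 (δ m)))
    (hmin : ∀ α : A, ∑ m, s m ≤ ‖(α : ℂ)‖ ^ 2) {ε : ℝ} (hε0 : 0 < ε) (hs : 0 < s 0)
    {z : (A → ℝ) × (Fin 1 → ℝ)} (hz : z ∈ feasiblePairs A s ε) {β : ℝ}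
    (hβ : β < pairRate δ z.1 z.2) :
    ∀ᶠ N : ℕ in atTop, (β : EReal) ≤ annealedRate P A (a N) s (V N) ε := by
  simp only [Fin.sum_univ_one] at hmin
  obtain ⟨hz1, hz2, hz3⟩ := hz
  rw [Fin.sum_univ_one] at hz3
  have hE : ∑ α, z.1 α * (‖(α : ℂ)‖ ^ 2 - s 0) ≤ 0 := by
    have h : ∑ α, z.1 α * ‖(α : ℂ)‖ ^ 2 = z.2 0 := hz3
    simp only [mul_sub, Finset.sum_sub_distrib, ← Finset.sum_mul, hz1.2, h]
    linarith [(hz2 0).2]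
  have hnn : ∀ α ∈ Finset.univ, 0 ≤ z.1 α * (‖(α : ℂ)‖ ^ 2 - s 0) := fun α _ =>
    mul_nonneg (hz1.1 α) (sub_nonneg.2 (hmin α))
  have hzero := (Finset.sum_eq_zero_iff_of_nonneg hnn).1 (le_antisymm hE (Finset.sum_nonneg hnn))
  have hz20 : 0 < z.2 0 := by
    rw [← hz3, meanEnergy]
    refine hs.trans_le ?_
    calc s 0 = ∑ α, z.1 α * s 0 := by rw [← Finset.sum_mul, hz1.2, one_mul]
      _ ≤ _ := Finset.sum_le_sum fun α _ => mul_le_mul_of_nonneg_left (hmin α) (hz1.1 α)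
  set S : Finset A := Finset.univ.filter fun α => ‖(α : ℂ)‖ ^ 2 = s 0 with hS
  have hH : shannonEntropy z.1 ≤ Real.log S.card := by
    refine shannonEntropy_le_log_card hz1 fun α hα => ?_
    refine (mul_eq_zero.1 (hzero α (Finset.mem_univ α))).resolve_right fun h => hα ?_
    exact Finset.mem_filter.2 ⟨Finset.mem_univ _, sub_eq_zero.1 h⟩
  have hδ1 : δ 0 = 1 := by simpa using sum_eq_one_of_tendsto_bandFraction ha
  -- With one band, `δ 0 = 1` and the energy ratio is 1, so `pairRate` is just the entropy.
  have hβ' : β < Real.log S.card := by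
    refine lt_of_lt_of_le ?_ hH
    simpa [pairRate, hδ1, hz20.ne'] using hβ
  have hScard : 0 < S.card := by
    obtain ⟨α, -, hα⟩ : ∃ α ∈ Finset.univ, 0 < z.1 α :=
      Finset.exists_lt_of_sum_lt (f := fun _ => 0) (by simp [-Finset.univ_eq_attach, hz1.2])
    exact Finset.card_pos.2 ⟨α, Finset.mem_filter.2 ⟨Finset.mem_univ _,
      sub_eq_zero.1 ((mul_eq_zero.1 (hzero α (Finset.mem_univ α))).resolve_left hα.ne')⟩⟩
  filter_upwards [eventually_gt_atTop 0] with N hN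
  have hN' : (0 : ℝ) < N := by positivity
  refine le_annealedRate hN ?_
  rw [lintegral_card_admissibleSeqs (hV N).measurable]
  have hone : ∀ x ∈ Fintype.piFinset fun _ : Fin N => S, P {ω | ∀ m, bandEnergy (a N)
      ((V N ω : Matrix (Fin N) (Fin N) ℂ).mulVec fun k => (x k : ℂ)) m ∈
        Set.Icc (s m - ε) (s m)} = 1 := by
    intro x hx
    convert measure_univ (μ := P)
    rw [Set.eq_univ_iff_forall]
    intro ω m
    have hxk : ∀ k, ‖(x k : ℂ)‖ ^ 2 = s 0 := fun k =>
      (Finset.mem_filter.1 (Fintype.mem_piFinset.1 hx k)).2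
    have h := sum_bandEnergy_mulVec (a N) (V N ω) x
    rw [Fin.sum_univ_one, meanEnergy_empirical, totalEnergy, Finset.sum_congr rfl fun k _ => hxk k,
      Finset.sum_const, Finset.card_univ, Fintype.card_fin, nsmul_eq_mul,
      mul_div_cancel_left₀ _ hN'.ne'] at h
    rw [Subsingleton.elim m 0, h]
    exact ⟨by linarith, le_rfl⟩
  calc ENNReal.ofReal (Real.exp (N * β)) ≤ ENNReal.ofReal ((S.card : ℝ) ^ N) := by
        refine ENNReal.ofReal_le_ofReal ?_
        rw [← Real.exp_log (show (0 : ℝ) < S.card by positivity), ← Real.exp_nat_mul]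
        exact Real.exp_le_exp.2 (by gcongr)
    _ = ∑ x ∈ Fintype.piFinset fun _ : Fin N => S, (1 : ℝ≥0∞) := by
        rw [ENNReal.ofReal_pow (by positivity), ENNReal.ofReal_natCast]
        simp
    _ = ∑ x ∈ Fintype.piFinset fun _ : Fin N => S, P {ω | ∀ m, bandEnergy (a N)
          ((V N ω : Matrix (Fin N) (Fin N) ℂ).mulVec fun k => (x k : ℂ)) m ∈
            Set.Icc (s m - ε) (s m)} := (Finset.sum_congr rfl hone).symm
    _ ≤ _ := Finset.sum_le_sum_of_subset (Finset.subset_univ _)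

/-- Zero energy in a nonempty band is a null event for a nonzero vector, and the zero vector lacks
energy in band `m₁`; the expected count is eventually exactly 0. -/
theorem tendsto_annealedRate_of_eq_zero (hV : ∀ N, IsHaarDistributed P (V N))
    (hδ : ∀ m, 0 < δ m) (ha : ∀ m, Tendsto (fun N => bandFraction (a N) m) atTop (𝓝 (δ m)))
    {m₀ m₁ : Fin M} (hm₀ : s m₀ = 0) {ε : ℝ} (hε : ε < s m₁) :
    Tendsto (fun N => annealedRate P A (a N) s (V N) ε) atTop (𝓝 ⊥) := by
  refine tendsto_const_nhds.congr' ?_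
  filter_upwards [eventually_gt_atTop 0, eventually_forall_bandSize_pos hδ ha] with N hN hn
  have hN' : (0 : ℝ) < N := by positivity
  rw [annealedRate, lintegral_card_admissibleSeqs (hV N).measurable, Finset.sum_eq_zero,
    ENNReal.log_zero, EReal.bot_div_of_pos_ne_top (by exact_mod_cast hN') (EReal.coe_ne_top _)]
  intro x _
  by_cases hx : (fun k => (x k : ℂ)) = 0
  · convert measure_empty (μ := P)
    rw [Set.eq_empty_iff_forall_notMem]
    intro ω hω
    have := (hω m₁).1
    rw [hx, Matrix.mulVec_zero] at this
    simp [bandEnergy] at this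
    linarith
  -- The total energy is a vacuous bound in the other bands; the bound 0 in band `m₀` makes the
  -- weight vanish because the exponent `bandSize` is positive.
  · have hle := (hV N).measure_forall_bandSum_le (a N) hn
      (R := fun m => if m = m₀ then 0 else totalEnergy fun k => (x k : ℂ))
      (fun m => by split_ifs; exacts [le_rfl, totalEnergy_nonneg _]) hx
    have hzero : (bandWeight (a N) fun m => (if m = m₀ then 0 else
        totalEnergy fun k => (x k : ℂ)) / totalEnergy fun k => (x k : ℂ)) = 0 := by
      rw [bandWeight, Finset.prod_eq_zero (Finset.mem_univ m₀), mul_zero]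
      simp [(hn m₀).ne']
    rw [hzero, ENNReal.ofReal_zero] at hle
    refine le_antisymm ((measure_mono ?_).trans hle) zero_le
    intro ω hω m
    split_ifs with hm
    · have := (hω m).2
      rwa [hm, hm₀, bandEnergy_eq, div_le_iff₀ hN', zero_mul, ← hm] at this
    · rw [← totalEnergy_mulVec (V N ω), ← sum_bandSum (a N)]
      exact Finset.single_le_sum (fun m _ => bandSum_nonneg _ _ m) (Finset.mem_univ m)

end limits

/-! ### Assembly of the cases. -/

theorem theorem4 {Ω : Type*} [MeasurableSpace Ω] (P : Measure Ω) [IsProbabilityMeasure P]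
    (V : ∀ N : ℕ, Ω → Matrix.unitaryGroup (Fin N) ℂ) (hV : ∀ N, IsHaarDistributed P (V N))
    (A : Finset ℂ) (M : ℕ) (a : ∀ N : ℕ, Fin N → Fin M)
    (δ : Fin M → ℝ) (hδ : ∀ m, 0 < δ m)
    (ha : ∀ m, Tendsto (fun N => bandFraction (a N) m) atTop (𝓝 (δ m)))
    (s : Fin M → ℝ) (hs : ∀ m, 0 ≤ s m) (hs_tot : 0 < ∑ m, s m)
    (hs_min : M = 1 ∨ ¬ IsLeast ((fun x : ℂ => ‖x‖ ^ 2) '' (A : Set ℂ)) (∑ m, s m)) :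
    ∃ L : ℝ → EReal,
      (∀ᶠ ε in 𝓝[>] (0 : ℝ),
        Tendsto (fun N => annealedRate P A (a N) s (V N) ε) atTop (𝓝 (L ε))) ∧
      Tendsto L (𝓝[>] (0 : ℝ))
        (𝓝 (maxEntropy A (∑ m, s m) - relativeEntropy δ (fun m => s m / ∑ j, s j))) := by
  have hM : 0 < M := by
    rcases Nat.eq_zero_or_pos M with rfl | h
    · simp at hs_tot
    · exact h
  by_cases hpos : ∀ m, 0 < s m
  · refine ⟨fun ε => ⨆ z ∈ feasiblePairs A s ε, (pairRate δ z.1 z.2 : EReal), ?_,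
      tendsto_iSup_pairRate hM hδ hpos⟩
    have hlower : ∀ᶠ ε in 𝓝[>] (0 : ℝ), ∀ z ∈ feasiblePairs A s ε, ∀ β : ℝ,
        β < pairRate δ z.1 z.2 →
          ∀ᶠ N : ℕ in atTop, (β : EReal) ≤ annealedRate P A (a N) s (V N) ε := by
      by_cases hne : (distributionsWithSecondMoment A (∑ m, s m)).Nonempty
      · obtain ⟨p, hp⟩ := hne
        by_cases hex : ∃ α₀ : A, ‖(α₀ : ℂ)‖ ^ 2 < ∑ m, s m
        · obtain ⟨α₀, hα₀⟩ := hex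
          filter_upwards [eventually_forall_tolerance_lt hpos, self_mem_nhdsWithin] with ε hε hε0 z hz β hβ
          exact eventually_le_annealedRate hV hδ ha hM hp hα₀ hε0 hε hz hβ
        · push Not at hex
          -- A mean equal to `∑ m, s m` of energies that are all at least this large must be
          -- attained by a symbol, so `∑ m, s m` is the least energy, which is excluded unless `M =
          -- 1`.
          have hM1 : M = 1 := by
            refine hs_min.resolve_right fun h => h ⟨?_, ?_⟩
            · by_contra hcon
              have hlt : ∀ α : A, ∑ m, s m < ‖(α : ℂ)‖ ^ 2 := fun α =>
                lt_of_le_of_ne (hex α) fun h => hcon ⟨α, α.2, h.symm⟩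
              obtain ⟨α, -, hα⟩ : ∃ α ∈ Finset.univ, 0 < p α :=
                Finset.exists_lt_of_sum_lt (f := fun _ => 0) (by simp [-Finset.univ_eq_attach, hp.1.2])
              have : ∑ α, p α * ∑ m, s m < ∑ α, p α * ‖(α : ℂ)‖ ^ 2 :=
                Finset.sum_lt_sum (fun α _ => mul_le_mul_of_nonneg_left (hex α) (hp.1.1 α))
                  ⟨α, Finset.mem_univ _, mul_lt_mul_of_pos_left (hlt α) hα⟩
              rw [← Finset.sum_mul, hp.1.2, one_mul, hp.2] at this
              exact lt_irrefl _ this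
            · rintro _ ⟨α, hα, rfl⟩
              exact hex ⟨α, hα⟩
          subst hM1
          filter_upwards [self_mem_nhdsWithin] with ε hε0 z hz β hβ
          exact eventually_le_annealedRate_of_least hV ha hex hε0 (hpos 0) hz hβ
      · filter_upwards [eventually_feasiblePairs_eq_empty hne] with ε hε z hz
        rw [hε] at hz
        exact hz.elim
    filter_upwards [eventually_forall_tolerance_lt hpos, hlower] with ε hε hlow
    refine tendsto_order.2 ⟨fun b hb => ?_, fun b hb =>
      eventually_annealedRate_lt hV hδ ha hM hε hb⟩
    obtain ⟨z, hbz⟩ := lt_iSup_iff.1 hb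
    obtain ⟨hz, hbz⟩ := lt_iSup_iff.1 hbz
    obtain ⟨β, h1, h2⟩ := EReal.lt_iff_exists_real_btwn.1 hbz
    filter_upwards [hlow z hz β (EReal.coe_lt_coe_iff.1 h2)] with N hN
    exact h1.trans_le hN
  · push Not at hpos
    obtain ⟨m₀, hm₀⟩ := hpos
    have hm₀ : s m₀ = 0 := le_antisymm hm₀ (hs m₀)
    obtain ⟨m₁, -, hm₁⟩ := Finset.exists_lt_of_sum_lt (s := Finset.univ) (f := fun _ => 0) (g := s)
      (by simpa using hs_tot)
    have htop : relativeEntropy δ (fun m => s m / ∑ j, s j) = ⊤ := by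
      rw [relativeEntropy, if_neg]
      intro h
      exact (hδ m₀).ne' (h m₀ (by simp [hm₀]))
    refine ⟨fun _ => ⊥, ?_, ?_⟩
    · filter_upwards [(gt_mem_nhds hm₁).filter_mono nhdsWithin_le_nhds] with ε hε
      exact tendsto_annealedRate_of_eq_zero hV hδ ha hm₀ hε
    -- In `EReal`, `x + ⊥ = ⊥` for every `x`, so the value of `maxEntropy` is irrelevant here.
    · rw [htop, sub_eq_add_neg, EReal.neg_top, EReal.add_bot]
      exact tendsto_const_nhds
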